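/- **Definitions.** A *finite subdivision rule* $R$ of dimension $n$ consists of (1) a finite CW complex $S_R$ which is the union of its closed $n$-cells (tiles), such that for every tile there is a CW structure $s$ on the closed $n$-disk whose cells other than the open top cell lie in the boundary sphere, in which two distinct closed cells that meet do so in a single closed cell of lower dimension, and such that the characteristic map of the tile maps every open cell of $s$ homeomorphically onto an open cell of $S_R$; (2) a finite CW complex $R(S_R)$ subdividing $S_R$; (3) a partition of the tiles of $S_R$ into ideal and non-ideal ones; (4) a continuous cellular map $\varphi_R:R(S_R)\to S_R$ that maps each open cell homeomorphically onto an open cell, and the union of the ideal tiles into itself. An *$R$-complex* is a (possibly infinite) CW complex $X$ that is the union of its closed $n$-cells, with a continuous cellular map $f:X\to S_R$ that maps each open cell homeomorphically onto an open cell. Put $R^0(X)=X$, and let $R^{k+1}(X)$ be the subdivision of $R^k(X)$ obtained by pulling back the cells of $R(S_R)$ under $\varphi_R^k\circ f$ on each open cell. A tile of $R^k(X)$ is ideal if its image under $\varphi_R^k\circ f$ is an ideal tile; $\Lambda_k$ is the union of the closed non-ideal tiles of $R^k(X)$. The *history graph* $\Gamma=\Gamma(R,X)$ has as vertices an origin $O$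 and, for each $k\ge 0$, one vertex for each cell of $\Lambda_k$ (that is, each cell of $R^k(X)$ contained in $\Lambda_k$). Its edges are: *horizontal* edges joining two vertices of the same level $k$ when one of the two closed cells is properly contained in the other; and *vertical* edges joining $O$ to all vertices of level $0$, and the vertex of a cell $K$ of $\Lambda_k$ to the vertices of those cells of $\Lambda_{k+1}$ whose open cell is contained in the open cell $K$. It is considered as a metric graph, with edges of length $1$ and the path metric. A map $h:Y\to Z$ is a *quasi-isometric embedding* if for some constant $K>0$ one has $\frac1K d(y,y')-K\le d(h(y),h(y'))\le K d(y,y')+K$ for all $y,y'$; it is a *quasi-isometry* if in addition every $z\in Z$ has distance less than $K$ from some $h(y)$. For a space $Y$ with base point $O$, let $P$ be the set of continuous paths $\gamma:[0,b]\to Y$ with $\gamma(0)=O$, extended by $\gamma(t)=\gamma(b)$ for $t\ge b$, with the distance $d_P(\gamma_1,\gamma_2)=|b_1-b_2|+\sup_{t\ge0}d(\gamma_1(t),\gamma_2(t))$. A *combing* of $Y$ is a right inverse $\sigma:Y\to P$ of the endpoint map $\gamma\mapsto\gamma(b)$ that is a quasi-isometric embedding, and $Y$ is *combable* if it has a combing.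 A finitely generated group is *quasi-isometric to $Y$* if it has a Cayley graph (with respect to a finite generating set, as a metric graph) that is quasi-isometric to $Y$, and it is *combable* if its Cayley graphs with respect to finite generating sets, based at the identity, are combable. A group has a *quadratic isoperimetric inequality* if it is finitely presented and for every finite presentation there is a quadratic polynomial $q$ such that every reduced word $w$ of length $k$ representing the identity is a product of at most $q(k)$ conjugates of relators and inverses of relators. **Theorem.** Let $R$ be a finite subdivision rule, let $X$ be an $R$-complex, and let $\Gamma=\Gamma(R,X)$ be the history graph, with base point the origin $O$. 1. $\Gamma$ is combable. More precisely, there is a combing $\sigma$ of $\Gamma$ such that for every point $x$ of $\Gamma$ the path $\sigma(x)$ is a geodesic from $O$ to $x$ parametrized by arc length, and for every vertex $v$ of $\Gamma$ the geodesic $\sigma(v)$ is vertical, i.e. runs in the union of the vertical edges. 2. Every finitely generated group that is quasi-isometric to $\Gamma$ is combable and has a quadratic isoperimetric inequality. -/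

import Mathlib

open Set Topology
open scoped NNReal ENNReal

/-! ### Quasi-isometries (for spaces whose distance may take the value `∞`) -/

/-- `f` is a quasi-isometric embedding with constant `K`:
`d(x,y)/K - K ≤ d(f x, f y) ≤ K d(x,y) + K`. -/
def IsQuasiIsometricEmbeddingWith {X Y : Type*} [EDist X] [EDist Y] (K : ℝ≥0) (f : X → Y) : Prop :=
  0 < K ∧ ∀ x y : X, edist x y / K ≤ edist (f x) (f y) + K ∧
    edist (f x) (f y) ≤ K * edist x y + K

def IsQuasiIsometricEmbedding {X Y : Type*} [EDist X] [EDist Y] (f : X → Y) : Prop :=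
  ∃ K : ℝ≥0, IsQuasiIsometricEmbeddingWith K f

def IsQuasiIsometry {X Y : Type*} [EDist X] [EDist Y] (f : X → Y) : Prop :=
  ∃ K : ℝ≥0, IsQuasiIsometricEmbeddingWith K f ∧ ∀ y : Y, ∃ x : X, edist y (f x) < K

/-! ### Combings -/

/-- A path `γ : [0, len] → X` starting at the base point `O`, extended to `[0, ∞)` by the constant
value `γ(len)`. -/
structure BasedPath (X : Type*) [TopologicalSpace X] (O : X) where
  len : ℝ≥0
  toFun : ℝ≥0 → X
  continuous_toFun : Continuous toFun
  map_zero : toFun 0 = O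
  map_of_len_le : ∀ t, len ≤ t → toFun t = toFun len

namespace BasedPath

variable {X : Type*} [PseudoEMetricSpace X] {O : X}

def endpoint (γ : BasedPath X O) : X := γ.toFun γ.len

/-- `d_P(γ₁, γ₂) = |b₁ - b₂| + sup_t d(γ₁(t), γ₂(t))`. -/
noncomputable instance : PseudoEMetricSpace (BasedPath X O) where
  edist γ₁ γ₂ := edist γ₁.len γ₂.len + ⨆ t, edist (γ₁.toFun t) (γ₂.toFun t)
  edist_self γ := by simp
  edist_comm γ₁ γ₂ := by simp only [edist_comm]
  edist_triangle γ₁ γ₂ γ₃ := by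
    have h : (⨆ t, edist (γ₁.toFun t) (γ₃.toFun t)) ≤
        (⨆ t, edist (γ₁.toFun t) (γ₂.toFun t)) + ⨆ t, edist (γ₂.toFun t) (γ₃.toFun t) :=
      iSup_le fun t => (edist_triangle _ (γ₂.toFun t) _).trans
        (add_le_add (le_iSup (fun t => edist (γ₁.toFun t) (γ₂.toFun t)) t)
          (le_iSup (fun t => edist (γ₂.toFun t) (γ₃.toFun t)) t))
    refine (add_le_add (edist_triangle γ₁.len γ₂.len γ₃.len) h).trans (le_of_eq ?_)
    ring

/-- The path is a geodesic parametrized by arc length. -/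
def IsGeodesic (γ : BasedPath X O) : Prop :=
  ∀ s t : ℝ≥0, s ≤ γ.len → t ≤ γ.len → edist (γ.toFun s) (γ.toFun t) = edist s t

end BasedPath

/-- A combing: a right inverse of the endpoint map that is a quasi-isometric embedding. -/
def IsCombing {X : Type*} [PseudoEMetricSpace X] {O : X} (σ : X → BasedPath X O) : Prop :=
  (∀ x, (σ x).endpoint = x) ∧ IsQuasiIsometricEmbedding σ

def IsCombable (X : Type*) [PseudoEMetricSpace X] (O : X) : Prop :=
  ∃ σ : X → BasedPath X O, IsCombing σ

/-! ### The metric graph of a simple graph -/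

/-- A point of the edge from `src` to `tgt`, at distance `pos` from `src`; or, if `src = tgt`, the
vertex `src` itself. A point may have several such names. -/
@[ext]
structure EdgePoint {V : Type*} (G : SimpleGraph V) where
  src : V
  tgt : V
  pos : ℝ≥0
  pos_le_one : pos ≤ 1
  adj_or_eq : G.Adj src tgt ∨ (src = tgt ∧ pos = 0)

namespace EdgePoint

variable {V : Type*} {G : SimpleGraph V}

/-- The two ends of the edge. -/
def vert (p : EdgePoint G) (a : Bool) : V := if a then p.tgt else p.src

/-- The distance along the edge to each of the two ends. -/
noncomputable def off (p : EdgePoint G) (a : Bool) : ℝ≥0 := if a then 1 - p.pos else p.pos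

lemma off_add_off_not (p : EdgePoint G) (a : Bool) : p.off a + p.off (!a) = 1 := by
  cases a
  · simpa [off] using add_tsub_cancel_of_le p.pos_le_one
  · simpa [off] using tsub_add_cancel_of_le p.pos_le_one

lemma edist_vert_le (p : EdgePoint G) (a b : Bool) :
    ((G.edist (p.vert a) (p.vert b) : ℕ∞) : ℝ≥0∞) ≤ p.off a + p.off b := by
  by_cases h : a = b
  · subst h; simp
  · obtain rfl : b = !a := by cases a <;> cases b <;> simp_all
    rw [← ENNReal.coe_add, off_add_off_not]
    have h1 : G.edist (p.vert a) (p.vert !a) ≤ 1 := by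
      rw [SimpleGraph.edist_le_one_iff_adj_or_eq]
      rcases p.adj_or_eq with h' | ⟨h', -⟩
      · left
        cases a
        · exact h'
        · exact h'.symm
      · right
        cases a
        · exact h'
        · exact h'.symm
    calc ((G.edist (p.vert a) (p.vert !a) : ℕ∞) : ℝ≥0∞) ≤ ((1 : ℕ∞) : ℝ≥0∞) := by
          exact_mod_cast h1
      _ = _ := by simp

/-- The length of a shortest path from `p` to `q` passing through the end `a` of the edge of `p` and
the end `b` of the edge of `q`. -/
noncomputable def viaEnds (p q : EdgePoint G) (a b : Bool) : ℝ≥0∞ :=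
  p.off a + ((G.edist (p.vert a) (q.vert b) : ℕ∞) : ℝ≥0∞) + q.off b

/-- `p` and `q` lie on the same edge, the end `a` of the first being the end `b` of the second. -/
def SameEdge (p q : EdgePoint G) (a b : Bool) : Prop :=
  p.vert a = q.vert b ∧ p.vert (!a) = q.vert (!b)

/-- The path distance: either along a common edge, or through ends of the two edges. -/
noncomputable def pathDist (p q : EdgePoint G) : ℝ≥0∞ :=
  (⨅ (a : Bool) (b : Bool) (_ : SameEdge p q a b), edist (p.off a) (q.off b)) ⊓
    ⨅ (a : Bool) (b : Bool), viaEnds p q a b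

lemma pathDist_le_along {p q : EdgePoint G} {a b : Bool} (h : SameEdge p q a b) :
    pathDist p q ≤ edist (p.off a) (q.off b) :=
  inf_le_left.trans (iInf_le_of_le a (iInf_le_of_le b (iInf_le _ h)))

lemma pathDist_le_via (p q : EdgePoint G) (a b : Bool) : pathDist p q ≤ viaEnds p q a b :=
  inf_le_right.trans (iInf_le_of_le a (iInf_le _ b))

lemma le_pathDist {p q : EdgePoint G} {x : ℝ≥0∞}
    (h1 : ∀ a b, SameEdge p q a b → x ≤ edist (p.off a) (q.off b))
    (h2 : ∀ a b, x ≤ viaEnds p q a b) : x ≤ pathDist p q :=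
  le_inf (le_iInf fun a => le_iInf fun b => le_iInf fun h => h1 a b h)
    (le_iInf fun a => le_iInf fun b => h2 a b)

lemma pathDist_eq_or (p q : EdgePoint G) :
    (∃ a b, SameEdge p q a b ∧ pathDist p q = edist (p.off a) (q.off b)) ∨
      ∃ a b, pathDist p q = viaEnds p q a b := by
  by_contra! hc
  obtain ⟨hc1, hc2⟩ := hc
  have hlt : ∀ a b, pathDist p q < viaEnds p q a b := fun a b =>
    lt_of_le_of_ne (pathDist_le_via p q a b) (hc2 a b)
  have h2 : pathDist p q < ⨅ (a : Bool) (b : Bool), viaEnds p q a b := by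
    simp only [iInf_bool_eq]
    simp [hlt]
  have hlt1 : ∀ a b, pathDist p q < ⨅ (_ : SameEdge p q a b), edist (p.off a) (q.off b) := by
    intro a b
    by_cases h : SameEdge p q a b
    · simpa [h] using lt_of_le_of_ne (pathDist_le_along h) (hc1 a b h)
    · simpa [h] using lt_of_lt_of_le (hlt a b) le_top
  have h1 : pathDist p q <
      ⨅ (a : Bool) (b : Bool) (_ : SameEdge p q a b), edist (p.off a) (q.off b) := by
    rw [iInf_bool_eq, iInf_bool_eq, iInf_bool_eq]
    exact lt_min (lt_min (hlt1 _ _) (hlt1 _ _)) (lt_min (hlt1 _ _) (hlt1 _ _))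
  exact absurd (lt_min h1 h2) (lt_irrefl _)

lemma SameEdge.symm {p q : EdgePoint G} {a b : Bool} (h : SameEdge p q a b) : SameEdge q p b a :=
  ⟨h.1.symm, h.2.symm⟩

lemma SameEdge.not {p q : EdgePoint G} {a b : Bool} (h : SameEdge p q a b) :
    SameEdge p q (!a) (!b) := ⟨h.2, by simpa using h.1⟩

lemma edist_off_not (p q : EdgePoint G) (a b : Bool) :
    edist (p.off (!a)) (q.off (!b)) = edist (p.off a) (q.off b) := by
  have h1 := congrArg NNReal.toReal (p.off_add_off_not a)
  have h2 := congrArg NNReal.toReal (q.off_add_off_not b)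
  push_cast at h1 h2
  rw [edist_dist, edist_dist, NNReal.dist_eq, NNReal.dist_eq]
  congr 1
  rw [show (p.off (!a) : ℝ) - q.off (!b) = -((p.off a : ℝ) - q.off b) by linarith, abs_neg]

lemma off_le (p q : EdgePoint G) (a b : Bool) :
    (p.off a : ℝ≥0∞) ≤ edist (p.off a) (q.off b) + q.off b := by
  have h0 : ∀ x : ℝ≥0, edist x 0 = x := fun x => by
    rw [edist_nndist, NNReal.nndist_zero_eq_val']
  calc (p.off a : ℝ≥0∞) = edist (p.off a) 0 := (h0 _).symm
    _ ≤ edist (p.off a) (q.off b) + edist (q.off b) 0 := edist_triangle _ _ _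
    _ = _ := by rw [h0 (q.off b)]

lemma pathDist_comm (p q : EdgePoint G) : pathDist p q = pathDist q p := by
  have key : ∀ p q : EdgePoint G, pathDist p q ≤ pathDist q p := by
    intro p q
    refine le_pathDist (fun a b h => ?_) fun a b => ?_
    · rw [edist_comm]; exact pathDist_le_along h.symm
    · refine (pathDist_le_via p q b a).trans (le_of_eq ?_)
      simp only [viaEnds, SimpleGraph.edist_comm]
      ring
  exact le_antisymm (key p q) (key q p)

/-- Moving along an edge and then through ends. -/
lemma pathDist_triangle_aux {p q r : EdgePoint G} {a b c d : Bool} (h : SameEdge p q a b) :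
    pathDist p r ≤ edist (p.off a) (q.off b) + viaEnds q r c d := by
  have main : ∀ a b, SameEdge p q a b → pathDist p r ≤
      edist (p.off a) (q.off b) + viaEnds q r b d := by
    intro a b h
    refine (pathDist_le_via p r a d).trans ?_
    simp only [viaEnds, h.1, ← add_assoc]
    gcongr
    exact off_le p q a b
  by_cases hbc : c = b
  · subst hbc; exact main a c h
  · obtain rfl : c = !b := by cases c <;> cases b <;> simp_all
    rw [← edist_off_not]
    exact main _ _ h.not

lemma pathDist_triangle (p q r : EdgePoint G) : pathDist p r ≤ pathDist p q + pathDist q r := by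
  rcases pathDist_eq_or p q with ⟨a, b, h, e⟩ | ⟨a, b, e⟩ <;>
  rcases pathDist_eq_or q r with ⟨c, d, h', e'⟩ | ⟨c, d, e'⟩ <;> rw [e, e']
  · have main : ∀ a b, SameEdge p q a b → ∀ d, SameEdge q r b d → pathDist p r ≤
        edist (p.off a) (q.off b) + edist (q.off b) (r.off d) := fun a b h d h' =>
      (pathDist_le_along (p := p) (q := r) (a := a) (b := d)
        ⟨h.1.trans h'.1, h.2.trans h'.2⟩).trans (edist_triangle _ _ _)
    by_cases hbc : c = b
    · subst hbc; exact main a c h d h'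
    · obtain rfl : c = !b := by cases c <;> cases b <;> simp_all
      rw [← edist_off_not]
      exact main _ _ h.not d h'
  · exact pathDist_triangle_aux h
  · rw [pathDist_comm p r, add_comm, edist_comm]
    refine (pathDist_triangle_aux (c := b) (d := a) h'.symm).trans (le_of_eq ?_)
    congr 1
    simp only [viaEnds, SimpleGraph.edist_comm]
    ring
  · refine (pathDist_le_via p r a d).trans ?_
    have h1 : ((G.edist (p.vert a) (r.vert d) : ℕ∞) : ℝ≥0∞) ≤
        ((G.edist (p.vert a) (q.vert b) : ℕ∞) : ℝ≥0∞) +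
          ((G.edist (q.vert b) (q.vert c) : ℕ∞) : ℝ≥0∞) +
          ((G.edist (q.vert c) (r.vert d) : ℕ∞) : ℝ≥0∞) := by
      rw [← ENat.toENNReal_add, ← ENat.toENNReal_add]
      exact ENat.toENNReal_mono ((SimpleGraph.edist_triangle (v := q.vert c)).trans
        (add_le_add SimpleGraph.edist_triangle le_rfl))
    have h2 := edist_vert_le q b c
    calc viaEnds p r a d ≤ p.off a + (((G.edist (p.vert a) (q.vert b) : ℕ∞) : ℝ≥0∞) +
          (q.off b + q.off c) + ((G.edist (q.vert c) (r.vert d) : ℕ∞) : ℝ≥0∞)) + r.off d := by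
          unfold viaEnds
          gcongr
          exact h1.trans (by gcongr)
      _ = viaEnds p q a b + viaEnds q r c d := by simp only [viaEnds]; ring

noncomputable instance : PseudoEMetricSpace (EdgePoint G) where
  edist := pathDist
  edist_self p := by
    refine le_antisymm ((pathDist_le_along (a := false) (b := false) ⟨rfl, rfl⟩).trans ?_) bot_le
    simp
  edist_comm := pathDist_comm
  edist_triangle := pathDist_triangle

end EdgePoint

/-- The metric graph of `G`: every edge is a segment of length `1`, and the distance is the path
distance, with value `∞` between different components. -/
abbrev SimpleGraph.MetricGraph {V : Type*} (G : SimpleGraph V) : Type _ :=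
  SeparationQuotient (EdgePoint G)

/-- The point of the metric graph given by a vertex. -/
noncomputable def SimpleGraph.vertexPoint {V : Type*} (G : SimpleGraph V) (v : V) : G.MetricGraph :=
  SeparationQuotient.mk ⟨v, v, 0, zero_le_one, Or.inr ⟨rfl, rfl⟩⟩

/-! ### Subdivision rules -/

/-- The open `k`-cells of a CW complex, as subsets of the ambient space. -/
def openCells {X : Type*} [TopologicalSpace X] {C : Set X} (cw : CWComplex C) (k : ℕ) :
    Set (Set X) :=
  range fun i : RelCWComplex.cell C k => RelCWComplex.openCell k i

/-- `f` maps every open `k`-cell of the source homeomorphically onto an open `k`-cell of the target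
(in particular `f` is cellular). -/
def IsCellwiseHomeo {X Y : Type*} [TopologicalSpace X] [TopologicalSpace Y]
    (A : ℕ → Set (Set X)) (B : ℕ → Set (Set Y)) (f : X → Y) : Prop :=
  ∀ k, ∀ e ∈ A k, f '' e ∈ B k ∧ IsEmbedding (e.domRestrict f)

/-- A CW structure on the closed `n`-disk with open top cell the interior, all other cells in the
boundary sphere, any two distinct closed cells that meet doing so in a single closed cell of lower
dimension. -/
def IsTileDisk {n : ℕ} (s : CWComplex (Metric.closedBall (0 : Fin n → ℝ) 1)) : Prop :=
  (∀ k, ∀ e ∈ openCells s k, e = Metric.ball 0 1 ∨ e ⊆ Metric.sphere 0 1) ∧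
  ∀ k l, ∀ e ∈ openCells s k, ∀ e' ∈ openCells s l, e ≠ e' →
    (closure e ∩ closure e').Nonempty →
      ∃ m < max k l, ∃ c ∈ openCells s m, closure e ∩ closure e' = closure c

universe u v w

/-- A (coloured) finite subdivision rule of dimension `n`. Cells are referred to through the open
cells as sets; in a Hausdorff CW complex the closed cell is the closure of the open cell. -/
structure SubdivisionRule (n : ℕ) where
  /-- The subdivision complex. -/
  S : Type u
  [top : TopologicalSpace S]
  [t2 : T2Space S]
  [cw : CWComplex (univ : Set S)]
  finite_cells : (⋃ k, openCells cw k).Finite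
  /-- The complex is the union of its closed `n`-cells. -/
  pure_dim : ⋃ e ∈ openCells cw n, closure e = univ
  /-- For every `n`-cell there is a cell structure on the closed `n`-disk whose open cells are
  mapped homeomorphically onto open cells by the characteristic map. -/
  tile_disk : ∀ i : RelCWComplex.cell (univ : Set S) n,
    ∃ s : CWComplex (Metric.closedBall (0 : Fin n → ℝ) 1), IsTileDisk s ∧
      IsCellwiseHomeo (openCells s) (openCells cw) (RelCWComplex.map (C := (univ : Set S)) n i)
  /-- The subdivision `R(S)` of `S`: a second finite CW structure on the same space. -/
  sub : CWComplex (univ : Set S)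
  sub_finite_cells : (⋃ k, openCells sub k).Finite
  /-- Every open cell of the subdivision lies in an open cell (of at least the same dimension). -/
  sub_refines : ∀ k, ∀ c ∈ openCells sub k, ∃ m, k ≤ m ∧ ∃ e ∈ openCells cw m, c ⊆ e
  /-- The ideal tiles; all other tiles are non-ideal. -/
  ideal : Set (Set S)
  ideal_subset : ideal ⊆ openCells cw n
  /-- The subdivision map `R(S) → S`. -/
  φ : S → S
  continuous_φ : Continuous φ
  φ_cellwise : IsCellwiseHomeo (openCells sub) (openCells cw) φ
  φ_ideal : MapsTo φ (⋃ e ∈ ideal, closure e) (⋃ e ∈ ideal, closure e)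

attribute [instance] SubdivisionRule.top SubdivisionRule.t2 SubdivisionRule.cw

/-- An `R`-complex, not necessarily finite. -/
structure SubdivisionRule.Complex {n : ℕ} (R : SubdivisionRule.{u} n) where
  X : Type v
  [top : TopologicalSpace X]
  [t2 : T2Space X]
  [cw : CWComplex (univ : Set X)]
  pure_dim : ⋃ e ∈ openCells cw n, closure e = univ
  f : X → R.S
  continuous_f : Continuous f
  f_cellwise : IsCellwiseHomeo (openCells cw) (openCells R.cw) f

attribute [instance] SubdivisionRule.Complex.top SubdivisionRule.Complex.t2
  SubdivisionRule.Complex.cw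

namespace SubdivisionRule.Complex

variable {n : ℕ} {R : SubdivisionRule.{u} n} (X : R.Complex)

/-- The structure map `φ^k ∘ f` of `R^k(X)`. -/
def levelMap (k : ℕ) : X.X → R.S := R.φ^[k] ∘ X.f

/-- The open `d`-cells of `R^k(X)`. The cells of `R^(k+1)(X)` in an open cell `e` of `R^k(X)` are
pulled back from the cells of `R(S)` in the open cell of `S` onto which `e` is mapped. -/
def cells : ℕ → ℕ → Set (Set X.X)
  | 0, d => openCells X.cw d
  | k + 1, d => {e' | ∃ m, ∃ e ∈ cells k m, ∃ c ∈ openCells R.sub d,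
      c ⊆ X.levelMap k '' e ∧ e' = e ∩ X.levelMap k ⁻¹' c}

/-- `Λ_k`, the union of the (closed) non-ideal tiles of `R^k(X)`. -/
def limitLevel (k : ℕ) : Set X.X :=
  ⋃ t ∈ {t ∈ X.cells k n | X.levelMap k '' t ∉ R.ideal}, closure t

/-- The (open) cells of `R^k(X)` that lie in `Λ_k`. -/
def limitCells (k : ℕ) : Set (Set X.X) := {e | (∃ d, e ∈ X.cells k d) ∧ e ⊆ X.limitLevel k}

/-- The vertices of the history graph: the origin `none`, and for each `k` the cells of `Λ_k`. -/
abbrev HistoryVertex : Type _ := Option (Σ k : ℕ, X.limitCells k)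

/-- Vertical edges, going up: from the origin to the cells of `Λ_0`, and from a cell of `Λ_k` to
the cells of `Λ_(k+1)` contained in its interior. -/
def IsBelow : X.HistoryVertex → X.HistoryVertex → Prop
  | none, some ⟨k, _⟩ => k = 0
  | some ⟨k, e⟩, some ⟨l, e'⟩ => l = k + 1 ∧ e'.1 ⊆ e.1
  | _, none => False

/-- Horizontal edges: a closed cell of `Λ_k` contained in a larger closed cell of `Λ_k`. -/
def IsFace : X.HistoryVertex → X.HistoryVertex → Prop
  | some ⟨k, e⟩, some ⟨l, e'⟩ => k = l ∧ closure e.1 ⊂ closure e'.1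
  | _, _ => False

/-- The history graph `Γ(R, X)`. -/
def historyGraph : SimpleGraph X.HistoryVertex where
  Adj u v := X.IsBelow u v ∨ X.IsBelow v u ∨ X.IsFace u v ∨ X.IsFace v u
  symm := ⟨fun u v h => by tauto⟩
  loopless := ⟨fun u h => by
    rcases u with _ | ⟨k, e⟩ <;> simp [IsBelow, IsFace] at h⟩

/-- The history graph as a metric space. -/
abbrev HistorySpace : Type _ := X.historyGraph.MetricGraph

noncomputable def origin : X.HistorySpace := X.historyGraph.vertexPoint none

/-- The union of all vertices and vertical edges. -/
def verticalPart : Set X.HistorySpace :=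
  {x | ∃ p : EdgePoint X.historyGraph, x = SeparationQuotient.mk p ∧
    (p.src = p.tgt ∨ X.IsBelow p.src p.tgt ∨ X.IsBelow p.tgt p.src)}

end SubdivisionRule.Complex

/-! ### Groups -/

section Groups

variable (G : Type*) [Group G]

/-- The Cayley graph of `G` with respect to `T`, as a metric space. -/
abbrev CayleySpace (T : Set G) : Type _ := (SimpleGraph.mulCayley T).MetricGraph

/-- `G` is a finitely generated group with a Cayley graph quasi-isometric to `Y`. -/
def IsGroupQuasiIsometricTo (Y : Type*) [EDist Y] : Prop :=
  ∃ T : Set G, T.Finite ∧ Subgroup.closure T = ⊤ ∧ ∃ f : CayleySpace G T → Y, IsQuasiIsometry f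

/-- The Cayley graphs of `G` with respect to finite generating sets are combable. -/
def IsCombableGroup : Prop :=
  ∀ T : Set G, T.Finite → Subgroup.closure T = ⊤ →
    IsCombable (CayleySpace G T) ((SimpleGraph.mulCayley T).vertexPoint 1)

/-- The least number of conjugates of relators (or inverses of relators) whose product is `w`. -/
noncomputable def wordArea {α : Type*} (rels : Set (FreeGroup α)) (w : FreeGroup α) : ℕ∞ :=
  ⨅ (l : List (FreeGroup α × FreeGroup α)) (_ : (∀ p ∈ l, p.2 ∈ rels ∨ p.2⁻¹ ∈ rels) ∧
    (l.map fun p => p.1⁻¹ * p.2 * p.1).prod = w), (l.length : ℕ∞)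

variable {G}

/-- The largest area of a reduced word of length `k` that represents the identity. -/
noncomputable def isoperimetricFunction {α : Type*} [DecidableEq α] (π : FreeGroup α →* G)
    (rels : Set (FreeGroup α)) (k : ℕ) : ℕ∞ :=
  ⨆ (w : FreeGroup α) (_ : w ∈ π.ker ∧ w.norm = k), wordArea rels w

variable (G)

/-- `G` is finitely presented, and the isoperimetric function of every finite presentation is
bounded above by a quadratic polynomial. -/
def HasQuadraticIsoperimetricInequality : Prop :=
  Group.IsFinitelyPresented G ∧
  ∀ (m : ℕ) (π : FreeGroup (Fin m) →* G) (rels : Set (FreeGroup (Fin m))),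
    Function.Surjective π → rels.Finite → Subgroup.normalClosure rels = π.ker →
      ∃ a b c : ℕ, ∀ k : ℕ, isoperimetricFunction π rels k ≤ ((a * k ^ 2 + b * k + c : ℕ) : ℕ∞)

end Groups

/-! ### Open cells of a CW complex as sets -/

section OpenCells

variable {X : Type*} [TopologicalSpace X] {C : Set X} (cw : CWComplex C)

/-! The geometric core is that going down the history graph does not increase distances. A cell of
`Λ_(k+1)` lies in exactly one cell of `Λ_k`, its `parent`: `Λ_(k+1) ⊆ Λ_k` because `φ` preserves the
union of the ideal tiles (`limitLevel_succ_subset`). If one cell is a face of another, their parents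
are equal or again in the face relation (`parent_eq_or_face`). Hence the vertical paths to adjacent
vertices stay at distance at most 1. They are geodesics, since the height changes by at most 1 along
every edge and by exactly 1 along vertical ones. A point inside an edge is reached by the vertical
path to one of its ends, chosen so that the total is as short as possible.

The statement about parents needs closed cells in `Λ_k` to be unions of open cells, with the
dimension dropping on the boundary (`subset_closure_of_limitCells`). This is not part of the
definition of a CW complex. It holds for the cell structures on the disk in the definition of a
subdivision rule and is transported to the tiles of `R^k(X)`. The characteristic map of a tile of
`S` is lifted through `φ^k ∘ f`, first on the open disk, and then to the closed disk because the
fibres are finite (`exists_extension_lift`). The open cells of the disk are connected, so their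
lifts are single cells of `R^k(X)` (`image_mem_cells`, `exists_tile_map`).

For the second claim, the combing is transported to the group by sampling its geodesics at integer
times and applying a coarse inverse of the quasi-isometry (`exists_boundedCombing`). Balls in a
Cayley graph are finite, so only finitely many group elements occur as steps of the resulting
sequences, or, for a fixed generator `s`, as differences between the sequences of `g` and `g * s`.
Filling in each step by an edge path gives combings of all Cayley graphs. Lifted to a free group,
two such neighbouring sequences bound a strip of squares taken from a finite set. A relation of
length `k` is a stack of `k` strips of length `O(k)`, and its area is therefore quadratic
(`exists_finite_quadratic`). -/

lemma openCells_nonempty {k : ℕ} {e : Set X} (he : e ∈ openCells cw k) : e.Nonempty := by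
  obtain ⟨i, rfl⟩ := he
  exact RelCWComplex.openCell_nonempty k i

lemma openCells_eq_of_mem {k l : ℕ} {e e' : Set X} (he : e ∈ openCells cw k)
    (he' : e' ∈ openCells cw l) {x : X} (hx : x ∈ e) (hx' : x ∈ e') : e = e' ∧ k = l := by
  obtain ⟨i, rfl⟩ := he
  obtain ⟨j, rfl⟩ := he'
  have h : (⟨k, i⟩ : Σ n, RelCWComplex.cell C n) = ⟨l, j⟩ := by
    by_contra hne
    exact (disjoint_left.1 (RelCWComplex.disjoint_openCell_of_ne hne)) hx hx'
  cases h
  exact ⟨rfl, rfl⟩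

lemma exists_openCells_mem {x : X} (hx : x ∈ C) : ∃ k, ∃ e ∈ openCells cw k, x ∈ e := by
  rw [← CWComplex.iUnion_openCell_eq_complex (C := C)] at hx
  simp only [mem_iUnion] at hx
  obtain ⟨k, i, hi⟩ := hx
  exact ⟨k, _, ⟨i, rfl⟩, hi⟩

lemma openCells_subset {k : ℕ} {e : Set X} (he : e ∈ openCells cw k) : e ⊆ C := by
  obtain ⟨i, rfl⟩ := he
  exact RelCWComplex.openCell_subset_complex k i

lemma isPreconnected_of_mem_openCells {k : ℕ} {e : Set X} (he : e ∈ openCells cw k) :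
    IsPreconnected e := by
  obtain ⟨i, rfl⟩ := he
  exact (convex_ball (0 : Fin k → ℝ) 1).isPreconnected.image _
    ((RelCWComplex.continuousOn k i).mono Metric.ball_subset_closedBall)

variable [T2Space X]

lemma isCompact_closure_of_mem_openCells {k : ℕ} {e : Set X} (he : e ∈ openCells cw k) :
    IsCompact (closure e) := by
  obtain ⟨i, rfl⟩ := he
  rw [RelCWComplex.closure_openCell_eq_closedCell]
  exact RelCWComplex.isCompact_closedCell

lemma closure_openCells_subset {k : ℕ} {e : Set X} (he : e ∈ openCells cw k) : closure e ⊆ C := by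
  obtain ⟨i, rfl⟩ := he
  rw [RelCWComplex.closure_openCell_eq_closedCell]
  exact RelCWComplex.closedCell_subset_complex k i

/-- The closure of an open cell is covered by the cell and finitely many cells of lower
dimension. -/
lemma exists_finite_cover_closure {k : ℕ} {e : Set X} (he : e ∈ openCells cw k) :
    ∃ F : Set (Set X), F.Finite ∧ (∀ c ∈ F, ∃ m < k, c ∈ openCells cw m) ∧
      closure e ⊆ e ∪ ⋃₀ F := by
  obtain ⟨i, rfl⟩ := he
  obtain ⟨I, hI⟩ := CWComplex.cellFrontier_subset_finite_openCell k i
  refine ⟨⋃ m ∈ {m | m < k}, (fun j => RelCWComplex.openCell m j) '' (↑(I m) : Set (RelCWComplex.cell C m)), ?_, ?_, ?_⟩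
  · exact (finite_lt_nat k).biUnion fun m _ => (I m).finite_toSet.image _
  · intro c hc
    simp only [mem_iUnion, mem_image] at hc
    obtain ⟨m, hm, j, -, rfl⟩ := hc
    exact ⟨m, hm, j, rfl⟩
  · rw [RelCWComplex.closure_openCell_eq_closedCell,
      ← RelCWComplex.cellFrontier_union_openCell_eq_closedCell, union_comm]
    refine union_subset_union_right _ fun x hx => ?_
    have := hI hx
    simp only [mem_iUnion] at this
    obtain ⟨m, hm, j, hj, hx⟩ := this
    exact ⟨_, mem_biUnion (show m ∈ {m | m < k} from hm) ⟨j, hj, rfl⟩, hx⟩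

/-- The frontier of a cell is covered by cells of lower dimension, and open cells are disjoint. This
dimension comparison replaces any argument on invariance of domain. -/
lemma eq_or_lt_of_mem_closure {k l : ℕ} {e e' : Set X} (he : e ∈ openCells cw k)
    (he' : e' ∈ openCells cw l) {x : X} (hx : x ∈ closure e) (hx' : x ∈ e') :
    (e' = e ∧ l = k) ∨ l < k := by
  obtain ⟨F, -, hF, hsub⟩ := exists_finite_cover_closure cw he
  rcases hsub hx with h | ⟨c, hc, h⟩
  · exact Or.inl (openCells_eq_of_mem cw he' he hx' h)
  · obtain ⟨m, hm, hc'⟩ := hF c hc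
    exact Or.inr ((openCells_eq_of_mem cw he' hc' hx' h).2 ▸ hm)

/-- Closure finiteness. Pulled back through the subdivisions, it is what makes the fibres of the
level maps on closed cells finite. -/
lemma finite_openCells_meeting_closure {k : ℕ} {e : Set X} (he : e ∈ openCells cw k) :
    {c | (∃ m, c ∈ openCells cw m) ∧ (c ∩ closure e).Nonempty}.Finite := by
  obtain ⟨F, hfin, hF, hsub⟩ := exists_finite_cover_closure cw he
  refine (hfin.insert e).subset ?_
  rintro c ⟨⟨m, hc⟩, x, hxc, hx⟩
  rcases hsub hx with h | ⟨c', hc', h⟩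
  · exact Or.inl (openCells_eq_of_mem cw hc he hxc h).1
  · obtain ⟨m', -, hm'⟩ := hF c' hc'
    exact Or.inr ((openCells_eq_of_mem cw hc hm' hxc h).1 ▸ hc')

end OpenCells

/-- In a tile, every closed cell is a union of open cells. -/
lemma IsTileDisk.openCells_subset_closure {n : ℕ} {s : CWComplex (Metric.closedBall (0 : Fin n → ℝ) 1)}
    (hs : IsTileDisk s) {k l : ℕ} {e e' : Set (Fin n → ℝ)} (he : e ∈ openCells s k)
    (he' : e' ∈ openCells s l) (h : (closure e ∩ e').Nonempty) :
    e' ⊆ closure e ∧ ((e' = e ∧ l = k) ∨ l < k) := by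
  obtain ⟨x, hx, hx'⟩ := h
  have hdim := eq_or_lt_of_mem_closure s he he' hx hx'
  refine ⟨?_, hdim⟩
  rcases hdim with ⟨rfl, -⟩ | hlt
  · exact subset_closure
  have hne : e ≠ e' := by
    rintro rfl
    exact hlt.ne (openCells_eq_of_mem s he' he hx' hx').2
  obtain ⟨m, -, c, hc, heq⟩ := hs.2 k l e he e' he' hne ⟨x, hx, subset_closure hx'⟩
  have hxc : x ∈ closure c := heq ▸ ⟨hx, subset_closure hx'⟩
  obtain ⟨y, hy⟩ := openCells_nonempty s hc
  have hy' : y ∈ closure e' := (heq ▸ subset_closure hy : y ∈ closure e ∩ closure e').2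
  have h1 := eq_or_lt_of_mem_closure s hc he' hxc hx'
  have h2 := eq_or_lt_of_mem_closure s he' hc hy' hy
  -- Each of the two cells meets the closure of the other. If they were distinct, each would have
  -- smaller dimension than the other.
  have h3 : e' = c := by
    rcases h1 with h1 | h1
    · exact h1.1
    · rcases h2 with h2 | h2
      · exact h2.1.symm
      · omega
  subst h3
  exact subset_closure.trans (heq ▸ inter_subset_left)

/-! ### Extending lifts to the boundary of a disk -/

/-- A lift, through a finite-to-one map on a compact space, of a map of a closed disk that is
defined on the open disk extends to the closed disk. -/
theorem exists_extension_lift {E Y Z : Type*} [NormedAddCommGroup E] [NormedSpace ℝ E]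
    [TopologicalSpace Y] [CompactSpace Y] [T2Space Y] [TopologicalSpace Z] [T2Space Z]
    {f : Y → Z} (hf : Continuous f) (hfin : ∀ z, (f ⁻¹' {z}).Finite)
    {Ψ : E → Z} (hΨ : ContinuousOn Ψ (Metric.closedBall 0 1))
    {h : E → Y} (hh : ContinuousOn h (Metric.ball 0 1))
    (hfh : ∀ x ∈ Metric.ball (0 : E) 1, f (h x) = Ψ x) :
    ∃ H : E → Y, ContinuousOn H (Metric.closedBall 0 1) ∧ EqOn H h (Metric.ball 0 1) ∧
      ∀ x ∈ Metric.closedBall (0 : E) 1, f (H x) = Ψ x := by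
  have hcl : closure (Metric.ball (0 : E) 1) = Metric.closedBall 0 1 :=
    closure_ball 0 one_ne_zero
  have key : ∀ p ∈ Metric.closedBall (0 : E) 1, ∃ y,
      Filter.Tendsto h (𝓝[Metric.ball 0 1] p) (𝓝 y) := by
    intro p hp
    have hp' : p ∈ closure (Metric.ball (0 : E) 1) := hcl ▸ hp
    -- A continuous map from a compact to a Hausdorff space is closed, so an open set containing a
    -- fibre contains all nearby fibres.
    have step : ∀ W : Set Y, IsOpen W → f ⁻¹' {Ψ p} ⊆ W →
        ∀ᶠ x in 𝓝[Metric.ball 0 1] p, h x ∈ W := by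
      intro W hW hsub
      have hclosed : IsClosed (f '' Wᶜ) := (hW.isClosed_compl.isCompact.image hf).isClosed
      have hnot : Ψ p ∈ (f '' Wᶜ)ᶜ := by
        rintro ⟨y, hy, hfy⟩
        exact hy (hsub hfy)
      have ht : Filter.Tendsto Ψ (𝓝[Metric.ball 0 1] p) (𝓝 (Ψ p)) :=
        (hΨ p hp).mono_left (nhdsWithin_mono _ Metric.ball_subset_closedBall)
      filter_upwards [ht (hclosed.isOpen_compl.mem_nhds hnot), self_mem_nhdsWithin] with x hx hxb
      by_contra hc
      exact hx ⟨h x, hc, hfh x hxb⟩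
    obtain ⟨U, hU, hdisj⟩ := (hfin (Ψ p)).t2_separation
    have hW := step (⋃ y ∈ f ⁻¹' {Ψ p}, U y)
      (isOpen_biUnion fun y _ => (hU y).2) fun y hy => mem_biUnion hy (hU y).1
    obtain ⟨ε, hε, hball⟩ := Metric.mem_nhdsWithin_iff.1 hW
    -- `N` is convex, so `h '' N` is connected and lies in one of the disjoint neighbourhoods of the
    -- points of the fibre. That point of the fibre is the limit.
    set N := Metric.ball p ε ∩ Metric.ball (0 : E) 1 with hN
    obtain ⟨x₀, hx₀, hx₀'⟩ := Metric.mem_closure_iff.1 hp' ε hε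
    have hx₀N : x₀ ∈ N := ⟨by rwa [Metric.mem_ball, dist_comm], hx₀⟩
    have hNW : ∀ x ∈ N, h x ∈ ⋃ y ∈ f ⁻¹' {Ψ p}, U y := fun x hx => hball hx
    obtain ⟨y₀, hy₀, hxy₀⟩ := mem_iUnion₂.1 (hNW x₀ hx₀N)
    have hpre : IsPreconnected (h '' N) :=
      ((convex_ball p ε).inter (convex_ball 0 1)).isPreconnected.image _
        (hh.mono inter_subset_right)
    set V := ⋃ y ∈ (f ⁻¹' {Ψ p} \ {y₀}), U y with hV
    have hVopen : IsOpen V := isOpen_biUnion fun y _ => (hU y).2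
    have hUV : Disjoint (U y₀) V := by
      rw [hV, disjoint_iUnion₂_right]
      exact fun y hy => hdisj hy₀ hy.1 (Ne.symm hy.2)
    have hNU : h '' N ⊆ U y₀ := by
      refine hpre.subset_left_of_subset_union (hU y₀).2 hVopen hUV ?_ ⟨h x₀, ⟨x₀, hx₀N, rfl⟩, hxy₀⟩
      rintro _ ⟨x, hx, rfl⟩
      obtain ⟨y, hy, hxy⟩ := mem_iUnion₂.1 (hNW x hx)
      by_cases hyy : y = y₀
      · exact Or.inl (hyy ▸ hxy)
      · exact Or.inr (mem_biUnion (show y ∈ f ⁻¹' {Ψ p} \ {y₀} from ⟨hy, hyy⟩) hxy)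
    refine ⟨y₀, tendsto_nhds.2 fun O hO hyO => ?_⟩
    -- Together, `O` and the neighbourhoods of the other points cover the fibre. Since `h '' N`
    -- avoids the latter, `h` must enter `O`.
    have h1 := step (O ∪ V) (hO.union hVopen) (by
      intro y hy
      by_cases hyy : y = y₀
      · exact Or.inl (hyy ▸ hyO)
      · exact Or.inr (mem_biUnion (show y ∈ f ⁻¹' {Ψ p} \ {y₀} from ⟨hy, hyy⟩) (hU y).1))
    have h2 : N ∈ 𝓝[Metric.ball 0 1] p :=
      Filter.inter_mem (mem_nhdsWithin_of_mem_nhds (Metric.ball_mem_nhds p hε)) self_mem_nhdsWithin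
    filter_upwards [h1, h2] with x hx hxN
    exact hx.resolve_right fun hxV => disjoint_left.1 hUV (hNU ⟨x, hxN, rfl⟩) hxV
  have hcont : ContinuousOn (extendFrom (Metric.ball 0 1) h) (Metric.closedBall (0 : E) 1) :=
    continuousOn_extendFrom hcl.ge key
  have heq : EqOn (extendFrom (Metric.ball 0 1) h) h (Metric.ball (0 : E) 1) := fun x hx =>
    extendFrom_eq (subset_closure hx) (hh x hx)
  refine ⟨_, hcont, heq, ?_⟩
  have h3 : EqOn (f ∘ extendFrom (Metric.ball 0 1) h) Ψ (Metric.closedBall (0 : E) 1) := by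
    refine EqOn.of_subset_closure (s := Metric.ball (0 : E) 1) (fun x hx => ?_)
      (hf.comp_continuousOn hcont) hΨ Metric.ball_subset_closedBall hcl.ge
    simp [heq hx, hfh x hx]
  exact h3

/-! ### The cells of the iterated subdivisions -/

lemma IsCellwiseHomeo.injOn {X Y : Type*} [TopologicalSpace X] [TopologicalSpace Y]
    {A : ℕ → Set (Set X)} {B : ℕ → Set (Set Y)} {f : X → Y} (h : IsCellwiseHomeo A B f) {k : ℕ}
    {e : Set X} (he : e ∈ A k) : InjOn f e :=
  injOn_iff_injective.2 (h k e he).2.injective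

/-- A section of `f` over a set on which a continuous map is defined is continuous if `f` embeds the
image of the section. -/
lemma continuousOn_section {D X Y : Type*} [TopologicalSpace D] [TopologicalSpace X]
    [TopologicalSpace Y] {f : X → Y} {t : Set X} (ht : IsEmbedding (t.domRestrict f)) {A : Set D}
    {Ψ : D → Y} (hΨ : ContinuousOn Ψ A) {h : D → X} (hmaps : MapsTo h A t)
    (hfh : ∀ x ∈ A, f (h x) = Ψ x) : ContinuousOn h A := by
  rw [continuousOn_iff_continuous_domRestrict] at hΨ ⊢
  have h1 : Continuous (fun x : A => (⟨h x, hmaps x.2⟩ : t)) := by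
    rw [ht.continuous_iff]
    convert hΨ using 1
    funext x
    exact hfh x x.2
  exact continuous_subtype_val.comp h1

namespace SubdivisionRule.Complex

variable {n : ℕ} {R : SubdivisionRule.{u} n} (X : SubdivisionRule.Complex.{u, v} R)

lemma levelMap_succ (k : ℕ) (x : X.X) : X.levelMap (k + 1) x = R.φ (X.levelMap k x) := by
  simp only [levelMap, Function.comp_apply, Function.iterate_succ_apply']

lemma continuous_levelMap (k : ℕ) : Continuous (X.levelMap k) :=
  (R.continuous_φ.iterate k).comp X.continuous_f

/-- By induction: a cell of the next subdivision is embedded by the current level map onto a cell of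
`R(S)`, which `φ` embeds in turn onto a cell of `S`. -/
lemma cells_cellwise (k : ℕ) :
    IsCellwiseHomeo (X.cells k) (openCells R.cw) (X.levelMap k) := by
  induction k with
  | zero => exact X.f_cellwise
  | succ k ih =>
    rintro d _ ⟨m, e, he, c, hc, hce, rfl⟩
    have himage : X.levelMap k '' (e ∩ X.levelMap k ⁻¹' c) = c := by
      rw [image_inter_preimage, inter_eq_right.2 hce]
    have hcomp : X.levelMap (k + 1) = R.φ ∘ X.levelMap k := funext (X.levelMap_succ k)
    obtain ⟨h1, h2⟩ := R.φ_cellwise d c hc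
    refine ⟨by rwa [hcomp, image_comp, himage], ?_⟩
    have hmaps : MapsTo (X.levelMap k) (e ∩ X.levelMap k ⁻¹' c) c := fun x hx => hx.2
    have h3 : IsEmbedding (hmaps.restrict) := by
      refine IsEmbedding.of_comp ((X.continuous_levelMap k).restrict hmaps)
        continuous_subtype_val ?_
      exact (ih m e he).2.comp (IsEmbedding.inclusion inter_subset_left)
    have h4 := h2.comp h3
    convert h4 using 1
    funext x
    exact X.levelMap_succ k x

lemma cells_nonempty {k d : ℕ} {e : Set X.X} (he : e ∈ X.cells k d) : e.Nonempty :=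
  image_nonempty.1 (openCells_nonempty _ (X.cells_cellwise k d e he).1)

lemma cells_eq_of_mem {k d d' : ℕ} {e e' : Set X.X} (he : e ∈ X.cells k d)
    (he' : e' ∈ X.cells k d') {x : X.X} (hx : x ∈ e) (hx' : x ∈ e') : e = e' ∧ d = d' := by
  induction k generalizing d d' e e' with
  | zero => exact openCells_eq_of_mem _ he he' hx hx'
  | succ k ih =>
    obtain ⟨m, e, he, c, hc, hce, rfl⟩ := he
    obtain ⟨m', e', he', c', hc', hce', rfl⟩ := he'
    obtain ⟨rfl, rfl⟩ := ih he he' hx.1 hx'.1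
    obtain ⟨rfl, rfl⟩ := openCells_eq_of_mem _ hc hc' hx.2 hx'.2
    exact ⟨rfl, rfl⟩

lemma exists_cells_mem (k : ℕ) (x : X.X) : ∃ d, ∃ e ∈ X.cells k d, x ∈ e := by
  induction k with
  | zero => exact exists_openCells_mem _ (mem_univ x)
  | succ k ih =>
    obtain ⟨m, e, he, hx⟩ := ih
    obtain ⟨d, c, hc, hxc⟩ := exists_openCells_mem R.sub (mem_univ (X.levelMap k x))
    obtain ⟨m', -, E, hE, hcE⟩ := R.sub_refines d c hc
    obtain ⟨rfl, -⟩ := openCells_eq_of_mem _ hE (X.cells_cellwise k m e he).1 (hcE hxc)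
      (mem_image_of_mem _ hx)
    exact ⟨d, _, ⟨m, e, he, c, hc, hcE, rfl⟩, hx, hxc⟩

lemma exists_cells_zero_superset {k d : ℕ} {e : Set X.X} (he : e ∈ X.cells k d) :
    ∃ m, ∃ e₀ ∈ X.cells 0 m, e ⊆ e₀ := by
  induction k generalizing d e with
  | zero => exact ⟨d, e, he, Subset.rfl⟩
  | succ k ih =>
    obtain ⟨m, e, he, c, hc, hce, rfl⟩ := he
    obtain ⟨m', e₀, he₀, h⟩ := ih he
    exact ⟨m', e₀, he₀, inter_subset_left.trans h⟩

lemma finite_cells_meeting (k : ℕ) {m : ℕ} {e₀ : Set X.X} (he₀ : e₀ ∈ X.cells 0 m) :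
    {c | (∃ d, c ∈ X.cells k d) ∧ (c ∩ closure e₀).Nonempty}.Finite := by
  induction k with
  | zero => exact finite_openCells_meeting_closure _ he₀
  | succ k ih =>
    refine (ih.image2 (fun e c => e ∩ X.levelMap k ⁻¹' c) R.sub_finite_cells).subset ?_
    rintro _ ⟨⟨d, m', e, he, c, hc, hce, rfl⟩, x, hx, hx'⟩
    exact ⟨e, ⟨⟨m', he⟩, x, hx.1, hx'⟩, c, mem_iUnion.2 ⟨d, hc⟩, rfl⟩

lemma isCompact_closure_cells {k d : ℕ} {e : Set X.X} (he : e ∈ X.cells k d) :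
    IsCompact (closure e) := by
  obtain ⟨m, e₀, he₀, h⟩ := X.exists_cells_zero_superset he
  exact (isCompact_closure_of_mem_openCells _ he₀).of_isClosed_subset isClosed_closure
    (closure_mono h)

lemma finite_cells_meeting_closure {k l d : ℕ} {e : Set X.X} (he : e ∈ X.cells l d) :
    {c | (∃ d, c ∈ X.cells k d) ∧ (c ∩ closure e).Nonempty}.Finite := by
  obtain ⟨m, e₀, he₀, h⟩ := X.exists_cells_zero_superset he
  refine (X.finite_cells_meeting k he₀).subset fun c hc => ⟨hc.1, hc.2.mono ?_⟩
  exact inter_subset_inter_right _ (closure_mono h)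

/-- The level map is injective on each cell, and only finitely many cells meet a closed cell. -/
lemma finite_fiber_levelMap {k d : ℕ} {e : Set X.X} (he : e ∈ X.cells k d) (z : R.S) :
    (closure e ∩ X.levelMap k ⁻¹' {z}).Finite := by
  refine ((X.finite_cells_meeting_closure (k := k) he).biUnion
    (t := fun c => c ∩ X.levelMap k ⁻¹' {z}) ?_).subset ?_
  · rintro c ⟨⟨d', hc⟩, -⟩
    refine Set.Subsingleton.finite fun x hx y hy => ?_
    exact (X.cells_cellwise k).injOn hc hx.1 hy.1 (hx.2.trans hy.2.symm)
  · rintro x ⟨hx, hxz⟩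
    obtain ⟨d', c, hc, hxc⟩ := X.exists_cells_mem k x
    exact mem_biUnion (show c ∈ {c | _ ∧ _} from ⟨⟨d', hc⟩, x, hxc, hx⟩) ⟨hxc, hxz⟩

/-- The lift of a cell of the subdivision complex is a cell. -/
lemma image_mem_cells {k : ℕ} {D : Type*} [TopologicalSpace D] {γ : Set D} (hγ : IsPreconnected γ)
    {H : D → X.X} (hH : ContinuousOn H γ) {l m : ℕ} {e₀ : Set X.X} (he₀ : e₀ ∈ X.cells l m)
    (hmaps : MapsTo H γ (closure e₀)) {d : ℕ} {E : Set R.S} (hE : E ∈ openCells R.cw d)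
    (himage : X.levelMap k '' (H '' γ) = E) : H '' γ ∈ X.cells k d := by
  have hfin := X.finite_cells_meeting_closure (k := k) he₀
  obtain ⟨z, hz⟩ := openCells_nonempty _ hE
  rw [← himage] at hz
  obtain ⟨_, ⟨p₀, hp₀, rfl⟩, rfl⟩ := hz
  obtain ⟨d', e, he, hpe⟩ := X.exists_cells_mem k (H p₀)
  have hmem : ∀ p ∈ γ, X.levelMap k (H p) ∈ E := fun p hp =>
    himage ▸ mem_image_of_mem _ (mem_image_of_mem _ hp)
  have hlift : ∀ c d', c ∈ X.cells k d' → ∀ p ∈ γ, H p ∈ c → X.levelMap k '' c = E ∧ d' = d :=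
    fun c d' hc p hp hpc => openCells_eq_of_mem _ (X.cells_cellwise k d' c hc).1 hE
      (mem_image_of_mem _ hpc) (hmem p hp)
  -- Suppose points `q` tending to `p` have `H q ∈ c`. The point `y` of `c` with the same image as
  -- `H p` exists because `c` covers all of `E`. Since the level map embeds `c`, closeness of the
  -- images forces `H q` to be close to `y`, so the limit `H p` is `y`.
  have hclosed : ∀ c d', c ∈ X.cells k d' → IsClosed {p : γ | H p ∈ c} := by
    intro c d' hc
    rw [isClosed_iff_frequently]
    intro p hfreq
    obtain ⟨q, hq⟩ := hfreq.exists
    obtain ⟨hcE, -⟩ := hlift c d' hc q q.2 hq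
    obtain ⟨y, hyc, hy⟩ : X.levelMap k (H p) ∈ X.levelMap k '' c := hcE ▸ hmem p p.2
    have hHcont : Filter.Tendsto (fun q : γ => H q) (𝓝 p) (𝓝 (H p)) :=
      (continuousOn_iff_continuous_domRestrict.1 hH).tendsto p
    suffices H p = y by rw [mem_ofPred_eq, this]; exact hyc
    by_contra hne
    obtain ⟨U, V, hU, hV, hpU, hyV, hUV⟩ := t2_separation hne
    have hemb := (X.cells_cellwise k d' c hc).2
    obtain ⟨W, hW, hWV⟩ := hemb.isOpen_iff.1 (hV.preimage (continuous_subtype_val (p := (· ∈ c))))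
    have hyW : X.levelMap k (H p) ∈ W := by
      have : (⟨y, hyc⟩ : c) ∈ c.domRestrict (X.levelMap k) ⁻¹' W := by rw [hWV]; exact hyV
      rw [← hy]
      exact this
    have h1 : ∀ᶠ q : γ in 𝓝 p, X.levelMap k (H q) ∈ W :=
      (((X.continuous_levelMap k).tendsto _).comp hHcont) (hW.mem_nhds hyW)
    have h2 : ∀ᶠ q : γ in 𝓝 p, H q ∈ U := hHcont (hU.mem_nhds hpU)
    obtain ⟨q, hqc, hqW, hqU⟩ := (hfreq.and_eventually (h1.and h2)).exists
    have : (⟨H q, hqc⟩ : c) ∈ Subtype.val ⁻¹' V := by rw [← hWV]; exact hqW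
    exact disjoint_left.1 hUV hqU this
  have hsub : γ ⊆ H ⁻¹' e := by
    have hpre : PreconnectedSpace γ := isPreconnected_iff_preconnectedSpace.1 hγ
    -- The finitely many cells that can meet the image cut `γ` into disjoint closed pieces, so each
    -- piece is also open.
    have hclopen : IsClopen {p : γ | H p ∈ e} := by
      refine ⟨hclosed e d' he, ?_⟩
      have h3 : IsClosed (⋃ c ∈ ({c | (∃ d, c ∈ X.cells k d) ∧ (c ∩ closure e₀).Nonempty} \ {e}),
          {p : γ | H p ∈ c}) :=
        (hfin.sdiff).isClosed_biUnion fun c hc => hclosed c _ hc.1.1.choose_spec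
      convert h3.isOpen_compl using 1
      ext p
      simp only [mem_ofPred_eq, mem_compl_iff, mem_iUnion, not_exists]
      constructor
      · intro hp c hc hpc
        exact hc.2 (X.cells_eq_of_mem hc.1.1.choose_spec he hpc hp).1
      · intro hp
        obtain ⟨d'', c, hc, hpc⟩ := X.exists_cells_mem k (H p)
        by_contra hpe
        exact hp c ⟨⟨⟨d'', hc⟩, H p, hpc, hmaps p.2⟩, fun h => hpe (h ▸ hpc)⟩ hpc
    have huniv := hclopen.eq_univ ⟨⟨p₀, hp₀⟩, hpe⟩
    intro p hp
    have : (⟨p, hp⟩ : γ) ∈ {p : γ | H p ∈ e} := huniv ▸ mem_univ _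
    exact this
  obtain ⟨heE, rfl⟩ := hlift e d' he p₀ hp₀ hpe
  have : H '' γ = e := by
    refine subset_antisymm (image_subset_iff.2 hsub) fun y hy => ?_
    have : X.levelMap k y ∈ X.levelMap k '' (H '' γ) := himage.symm ▸ heE ▸ mem_image_of_mem _ hy
    obtain ⟨_, ⟨p, hp, rfl⟩, hpy⟩ := this
    exact (X.cells_cellwise k).injOn he (hsub hp) hy hpy ▸ mem_image_of_mem _ hp
  rwa [this]

/-- Every closed tile of `R^k(X)` is the image of a disk with a cell structure whose open cells are
mapped onto cells. -/
theorem exists_tile_map {k : ℕ} {t : Set X.X} (ht : t ∈ X.cells k n) :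
    ∃ s : CWComplex (Metric.closedBall (0 : Fin n → ℝ) 1), IsTileDisk s ∧
      ∃ H : (Fin n → ℝ) → X.X, ContinuousOn H (Metric.closedBall 0 1) ∧
        H '' Metric.closedBall 0 1 = closure t ∧
        ∀ d, ∀ γ ∈ openCells s d, H '' γ ∈ X.cells k d := by
  obtain ⟨hE, hemb⟩ := X.cells_cellwise k n t ht
  obtain ⟨i, hi⟩ := hE
  obtain ⟨s, hs, hsc⟩ := R.tile_disk i
  refine ⟨s, hs, ?_⟩
  set Ψ := RelCWComplex.map (C := (univ : Set R.S)) n i with hΨ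
  have hΨc : ContinuousOn Ψ (Metric.closedBall 0 1) := RelCWComplex.continuousOn n i
  have hΨball : Ψ '' Metric.ball 0 1 = X.levelMap k '' t := hi
  have hex : ∀ x ∈ Metric.ball (0 : Fin n → ℝ) 1, ∃ y ∈ t, X.levelMap k y = Ψ x := fun x hx =>
    hΨball.subset (mem_image_of_mem Ψ hx)
  have : CompactSpace (closure t) := isCompact_iff_compactSpace.1 (X.isCompact_closure_cells ht)
  obtain ⟨y₀, hy₀⟩ := X.cells_nonempty ht
  classical
  let h : (Fin n → ℝ) → closure t := fun x =>
    if hx : x ∈ Metric.ball (0 : Fin n → ℝ) 1 then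
      ⟨(hex x hx).choose, subset_closure (hex x hx).choose_spec.1⟩ else ⟨y₀, subset_closure hy₀⟩
  have hh : ∀ x ∈ Metric.ball (0 : Fin n → ℝ) 1, (h x : X.X) ∈ t ∧ X.levelMap k (h x) = Ψ x := by
    intro x hx
    simp only [h, hx, dif_pos]
    exact (hex x hx).choose_spec
  have hcont : ContinuousOn h (Metric.ball 0 1) := by
    have := continuousOn_section hemb (hΨc.mono Metric.ball_subset_closedBall)
      (h := fun x => (h x : X.X)) (fun x hx => (hh x hx).1) (fun x hx => (hh x hx).2)
    exact IsInducing.subtypeVal.continuousOn_iff.2 this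
  obtain ⟨H, hHc, hHeq, hHlift⟩ := exists_extension_lift
    (f := fun y : closure t => X.levelMap k y)
    ((X.continuous_levelMap k).comp continuous_subtype_val)
    (fun z => by
      refine Finite.of_finite_image (f := Subtype.val)
        ((X.finite_fiber_levelMap ht z).subset ?_) Subtype.val_injective.injOn
      rintro _ ⟨y, hy, rfl⟩
      exact ⟨y.2, hy⟩)
    hΨc hcont fun x hx => (hh x hx).2
  have hHc' : ContinuousOn (fun x => (H x : X.X)) (Metric.closedBall 0 1) :=
    continuous_subtype_val.comp_continuousOn hHc
  refine ⟨fun x => H x, hHc', ?_, ?_⟩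
  · refine subset_antisymm ?_ ?_
    · rintro _ ⟨x, -, rfl⟩
      exact (H x).2
    · refine closure_minimal ?_
        ((isCompact_closedBall (0 : Fin n → ℝ) 1).image_of_continuousOn hHc').isClosed
      intro y hy
      have : X.levelMap k y ∈ Ψ '' Metric.ball 0 1 := hΨball ▸ mem_image_of_mem _ hy
      obtain ⟨x, hx, hxy⟩ := this
      refine ⟨x, Metric.ball_subset_closedBall hx, ?_⟩
      refine (X.cells_cellwise k).injOn ht ?_ hy ((hHlift x (Metric.ball_subset_closedBall hx)).trans hxy)
      simp only [hHeq hx]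
      exact (hh x hx).1
  · intro d γ hγ
    have hγD := openCells_subset s hγ
    refine X.image_mem_cells (isPreconnected_of_mem_openCells s hγ) (hHc'.mono hγD) ht
      (fun x _ => (H x).2) (hsc d γ hγ).1 ?_
    rw [image_image]
    exact image_congr fun x hx => hHlift x (hγD hx)

end SubdivisionRule.Complex

namespace SubdivisionRule.Complex

variable {n : ℕ} {R : SubdivisionRule.{u} n} (X : SubdivisionRule.Complex.{u, v} R)

/-! ### Closures of cells and the parents of cells -/

/-- A cell that meets a closed tile is the image of an open cell of the disk. -/
lemma exists_eq_image_of_inter_closure {k d : ℕ} {t e : Set X.X}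
    {s : CWComplex (Metric.closedBall (0 : Fin n → ℝ) 1)} {H : (Fin n → ℝ) → X.X}
    (hHt : H '' Metric.closedBall 0 1 = closure t)
    (hH : ∀ d, ∀ γ ∈ openCells s d, H '' γ ∈ X.cells k d) (he : e ∈ X.cells k d)
    (h : (e ∩ closure t).Nonempty) : ∃ γ ∈ openCells s d, H '' γ = e := by
  obtain ⟨x, hxe, hxt⟩ := h
  rw [← hHt] at hxt
  obtain ⟨q, hq, rfl⟩ := hxt
  obtain ⟨d', γ, hγ, hqγ⟩ := exists_openCells_mem s hq
  obtain ⟨h1, rfl⟩ := X.cells_eq_of_mem (hH d' γ hγ) he (mem_image_of_mem _ hqγ) hxe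
  exact ⟨γ, hγ, h1⟩

/-- A closed tile is a union of cells, because the disk is a union of open cells and each of them is
mapped onto a cell. -/
lemma subset_closure_tile {k d : ℕ} {t e : Set X.X} (ht : t ∈ X.cells k n)
    (he : e ∈ X.cells k d) (h : (e ∩ closure t).Nonempty) : e ⊆ closure t := by
  obtain ⟨s, -, H, -, hHt, hH⟩ := X.exists_tile_map ht
  obtain ⟨γ, hγ, rfl⟩ := X.exists_eq_image_of_inter_closure hHt hH he h
  exact hHt ▸ image_mono (openCells_subset s hγ)

lemma subset_limitLevel {k d : ℕ} {e : Set X.X} (he : e ∈ X.cells k d)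
    (h : (e ∩ X.limitLevel k).Nonempty) : e ⊆ X.limitLevel k := by
  obtain ⟨x, hxe, hx⟩ := h
  obtain ⟨t, ht, hxt⟩ := mem_iUnion₂.1 hx
  exact (X.subset_closure_tile ht.1 he ⟨x, hxe, hxt⟩).trans
    (subset_biUnion_of_mem (u := fun t => closure t) ht)

/-- In `Λ_k` a closed cell is the union of the cell and of cells of lower dimension. -/
lemma subset_closure_of_limitCells {k d d' : ℕ} {e e' : Set X.X} (he : e ∈ X.cells k d)
    (hlim : e ⊆ X.limitLevel k) (he' : e' ∈ X.cells k d') (h : (e' ∩ closure e).Nonempty) :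
    e' ⊆ closure e ∧ (e' = e ∨ d' < d) := by
  obtain ⟨x, hx⟩ := X.cells_nonempty he
  obtain ⟨t, ht, hxt⟩ := mem_iUnion₂.1 (hlim hx)
  obtain ⟨s, hs, H, hHc, hHt, hH⟩ := X.exists_tile_map ht.1
  obtain ⟨γ, hγ, rfl⟩ := X.exists_eq_image_of_inter_closure hHt hH he ⟨x, hx, hxt⟩
  have hγD := closure_openCells_subset s hγ
  have hcl : closure (H '' γ) = H '' closure γ := by
    refine subset_antisymm ?_ ?_
    · exact closure_minimal (image_mono subset_closure)
        ((isCompact_closure_of_mem_openCells s hγ).image_of_continuousOn (hHc.mono hγD)).isClosed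
    · exact (hHc.mono hγD).image_closure
  rw [hcl] at h ⊢
  obtain ⟨_, hy, q, hq, rfl⟩ := h
  obtain ⟨d'', γ', hγ', hqγ'⟩ := exists_openCells_mem s (hγD hq)
  obtain ⟨rfl, rfl⟩ := X.cells_eq_of_mem (hH d'' γ' hγ') he' (mem_image_of_mem _ hqγ') hy
  obtain ⟨h1, h2⟩ := hs.openCells_subset_closure hγ hγ' ⟨q, hq, hqγ'⟩
  refine ⟨image_mono h1, h2.imp (fun h => by rw [h.1]) id⟩

lemma _root_.SubdivisionRule.dim_le (R : SubdivisionRule.{u} n) {m : ℕ} {E : Set R.S}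
    (hE : E ∈ openCells R.cw m) : m ≤ n := by
  obtain ⟨x, hx⟩ := openCells_nonempty _ hE
  have hx' : x ∈ ⋃ e ∈ openCells R.cw n, closure e := by rw [R.pure_dim]; trivial
  obtain ⟨t, ht, hxt⟩ := mem_iUnion₂.1 hx'
  rcases eq_or_lt_of_mem_closure _ ht hE hxt hx with h | h
  · exact h.2.le
  · exact h.le

/-- Cells of a subdivision lie in cells of at least their dimension, so a tile of `R^(k+1)(X)` lies
in a tile of `R^k(X)`. If the larger tile is ideal, `φ` maps the image of the smaller one to an open
`n`-cell that meets a closed ideal tile. Other open cells meeting it have lower dimension, so this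
`n`-cell is that ideal tile. -/
lemma limitLevel_succ_subset (k : ℕ) : X.limitLevel (k + 1) ⊆ X.limitLevel k := by
  refine iUnion₂_subset ?_
  rintro _ ⟨⟨m, t, ht, c, hc, hct, rfl⟩, hideal⟩
  obtain ⟨m', hm', E, hE, hcE⟩ := R.sub_refines n c hc
  have htE := (X.cells_cellwise k m t ht).1
  obtain ⟨z, hz⟩ := openCells_nonempty _ hc
  obtain ⟨rfl, rfl⟩ := openCells_eq_of_mem _ hE htE (hcE hz) (hct hz)
  obtain rfl : m' = n := le_antisymm (R.dim_le htE) hm'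
  refine (closure_mono inter_subset_left).trans
    (subset_biUnion_of_mem (u := fun t => closure t) (show t ∈ {t | _ ∧ _} from ⟨ht, ?_⟩))
  intro htideal
  apply hideal
  have himage : X.levelMap (k + 1) '' (t ∩ X.levelMap k ⁻¹' c) = R.φ '' c := by
    rw [show X.levelMap (k + 1) = R.φ ∘ X.levelMap k from funext (X.levelMap_succ k), image_comp,
      image_inter_preimage, inter_eq_right.2 hct]
  rw [himage]
  have hφc := (R.φ_cellwise _ c hc).1
  have hz' : R.φ z ∈ ⋃ e ∈ R.ideal, closure e :=
    R.φ_ideal (mem_biUnion htideal (subset_closure (hct hz)))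
  obtain ⟨E', hE', hzE'⟩ := mem_iUnion₂.1 hz'
  rcases eq_or_lt_of_mem_closure _ (R.ideal_subset hE') hφc hzE' (mem_image_of_mem _ hz) with h | h
  · rw [h.1]; exact hE'
  · exact absurd h (lt_irrefl _)

lemma limitCells_nonempty {k : ℕ} (e : X.limitCells k) : e.1.Nonempty :=
  X.cells_nonempty e.2.1.choose_spec

lemma exists_parent {k : ℕ} (e : X.limitCells (k + 1)) : ∃ p : X.limitCells k, e.1 ⊆ p.1 := by
  obtain ⟨_, ⟨d, m, p, hp, c, hc, hcp, rfl⟩, hlim⟩ := e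
  obtain ⟨x, hx⟩ := X.cells_nonempty (show _ ∈ X.cells (k + 1) d from ⟨m, p, hp, c, hc, hcp, rfl⟩)
  exact ⟨⟨p, ⟨m, hp⟩, X.subset_limitLevel hp ⟨x, hx.1, X.limitLevel_succ_subset k (hlim hx)⟩⟩,
    inter_subset_left⟩

/-- The cell of `Λ_k` that contains a given cell of `Λ_(k+1)`. -/
noncomputable def parent {k : ℕ} (e : X.limitCells (k + 1)) : X.limitCells k :=
  (X.exists_parent e).choose

lemma subset_parent {k : ℕ} (e : X.limitCells (k + 1)) : e.1 ⊆ (X.parent e).1 :=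
  (X.exists_parent e).choose_spec

lemma eq_parent {k : ℕ} {e : X.limitCells (k + 1)} {p : X.limitCells k} (h : e.1 ⊆ p.1) :
    p = X.parent e := by
  obtain ⟨x, hx⟩ := X.limitCells_nonempty e
  obtain ⟨d, hp⟩ := p.2.1
  obtain ⟨d', hp'⟩ := (X.parent e).2.1
  exact Subtype.ext (X.cells_eq_of_mem hp hp' (h hx) (X.subset_parent e hx)).1

/-- The parents of a cell and of a face of it are equal, or the first is a face of the second. -/
lemma parent_eq_or_face {k : ℕ} {e e' : X.limitCells (k + 1)} (h : closure e.1 ⊂ closure e'.1) :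
    X.parent e = X.parent e' ∨ closure (X.parent e).1 ⊂ closure (X.parent e').1 := by
  obtain ⟨x, hx⟩ := X.limitCells_nonempty e
  obtain ⟨d, hp⟩ := (X.parent e).2.1
  obtain ⟨d', hp'⟩ := (X.parent e').2.1
  have hmeet : ((X.parent e).1 ∩ closure (X.parent e').1).Nonempty :=
    ⟨x, X.subset_parent e hx, closure_mono (X.subset_parent e') (h.1 (subset_closure hx))⟩
  obtain ⟨h1, h2⟩ := X.subset_closure_of_limitCells hp' (X.parent e').2.2 hp hmeet
  rcases h2 with h2 | h2
  · exact Or.inl (Subtype.ext h2)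
  -- The inclusion is strict because the dimensions differ: the reverse inclusion would make the
  -- larger parent equal to the smaller one or of lower dimension.
  refine Or.inr ⟨closure_minimal h1 isClosed_closure, fun hle => ?_⟩
  obtain ⟨y, hy⟩ := X.limitCells_nonempty (X.parent e')
  obtain ⟨-, h3⟩ := X.subset_closure_of_limitCells hp (X.parent e).2.2 hp'
    ⟨y, hy, hle (subset_closure hy)⟩
  rcases h3 with h3 | h3
  · rw [h3] at hp'
    exact h2.ne (X.cells_eq_of_mem hp hp' (X.subset_parent e hx) (X.subset_parent e hx)).2
  · omega

end SubdivisionRule.Complex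

/-! ### Paths in metric graphs -/

lemma NNReal.edist_le_of_le_add {s t c : ℝ≥0} (h1 : s ≤ t + c) (h2 : t ≤ s + c) :
    edist s t ≤ c := by
  rw [edist_nndist, ENNReal.coe_le_coe, ← NNReal.coe_le_coe, coe_nndist, NNReal.dist_eq,
    abs_sub_le_iff]
  rw [← NNReal.coe_le_coe] at h1 h2
  push_cast at h1 h2
  constructor <;> linarith

lemma NNReal.edist_eq_of_add {s t c : ℝ≥0} (h : t = s + c) : edist s t = c := by
  subst h
  rw [edist_nndist, ENNReal.coe_inj, ← NNReal.coe_inj, coe_nndist, NNReal.dist_eq]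
  push_cast
  rw [sub_add_cancel_left, abs_neg, abs_of_nonneg c.coe_nonneg]

namespace EdgePoint

variable {V : Type*} {G : SimpleGraph V}

/-- A vertex as a point of the metric graph. -/
def vertex (G : SimpleGraph V) (v : V) : EdgePoint G :=
  ⟨v, v, 0, zero_le_one, Or.inr ⟨rfl, rfl⟩⟩

lemma vertex_vert (v : V) (a : Bool) : (vertex G v).vert a = v := by
  cases a <;> rfl

lemma edist_vertex_le (p : EdgePoint G) (a : Bool) : edist (vertex G (p.vert a)) p ≤ p.off a := by
  refine (pathDist_le_via _ _ false a).trans ?_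
  rw [viaEnds, vertex_vert]
  simp [vertex, off]

/-- Only routes through the ends of the edge matter: a point can share the degenerate edge of a
vertex only if it is that vertex. -/
lemma le_edist_vertex {o : V} {p : EdgePoint G} {x : ℝ≥0∞}
    (h : ∀ a, x ≤ ((G.edist o (p.vert a) : ℕ∞) : ℝ≥0∞) + p.off a) : x ≤ edist (vertex G o) p := by
  refine le_pathDist (fun a b hab => ?_) fun a b => ?_
  · have h1 : o = p.vert false ∧ p.src = p.tgt := by
      have h1 := hab.1
      have h2 := hab.2
      rw [vertex_vert] at h1 h2
      cases b <;> simp_all [vert]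
    have h2 : p.pos = 0 := by
      rcases p.adj_or_eq with h' | h'
      · exact absurd (h1.2 ▸ h') (G.loopless.irrefl _)
      · exact h'.2
    have h3 := h false
    rw [← h1.1] at h3
    simp only [SimpleGraph.edist_self, off, h2] at h3
    exact le_trans (by simpa using h3) bot_le
  · refine (h b).trans ?_
    rw [viaEnds, vertex_vert, add_assoc]
    exact le_add_self

lemma edist_vertex_vertex (v w : V) :
    edist (vertex G v) (vertex G w) = ((G.edist v w : ℕ∞) : ℝ≥0∞) := by
  refine le_antisymm ((pathDist_le_via _ _ false false).trans ?_) (le_edist_vertex fun a => ?_)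
  · rw [viaEnds, vertex_vert, vertex_vert]
    simp [off, vertex]
  · rw [vertex_vert]
    exact le_self_add

lemma edist_vertex_le_one {v w : V} (h : v = w ∨ G.Adj v w) :
    edist (vertex G v) (vertex G w) ≤ 1 := by
  rw [edist_vertex_vertex]
  have : G.edist v w ≤ 1 := SimpleGraph.edist_le_one_iff_adj_or_eq.2 h.symm
  calc ((G.edist v w : ℕ∞) : ℝ≥0∞) ≤ ((1 : ℕ∞) : ℝ≥0∞) := ENat.toENNReal_mono this
    _ = 1 := by simp

open Classical in
/-- The point at distance `s` from `v` on the edge from `v` to `w`; the vertex `v` if `v = w`. -/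
noncomputable def onEdge {v w : V} (h : v = w ∨ G.Adj v w) (s : ℝ≥0) (hs : s ≤ 1) : EdgePoint G :=
  if hvw : v = w then vertex G v else ⟨v, w, s, hs, Or.inl (h.resolve_left hvw)⟩

lemma edist_onEdge_le {v w : V} (h : v = w ∨ G.Adj v w) {s s' : ℝ≥0} (hs : s ≤ 1) (hs' : s' ≤ 1) :
    edist (onEdge h s hs) (onEdge h s' hs') ≤ edist s s' := by
  unfold onEdge
  split_ifs with hvw
  · simp
  · exact pathDist_le_along (a := false) (b := false) ⟨rfl, rfl⟩

lemma edist_vertex_onEdge_le {v w : V} (h : v = w ∨ G.Adj v w) {s : ℝ≥0} (hs : s ≤ 1) :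
    edist (vertex G v) (onEdge h s hs) ≤ s := by
  unfold onEdge
  split_ifs with hvw
  · simp
  · exact edist_vertex_le (⟨v, w, s, hs, _⟩ : EdgePoint G) false

lemma edist_onEdge_vertex_le {v w : V} (h : v = w ∨ G.Adj v w) {s : ℝ≥0} (hs : s ≤ 1) :
    edist (onEdge h s hs) (vertex G w) ≤ (1 - s : ℝ≥0) := by
  unfold onEdge
  split_ifs with hvw
  · simp [hvw]
  · rw [edist_comm]
    exact edist_vertex_le (⟨v, w, s, hs, _⟩ : EdgePoint G) true

/-- The point at time `t` of the path that runs through a sequence of vertices at unit speed. -/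
noncomputable def walk (u : ℕ → V) (hu : ∀ i, u i = u (i + 1) ∨ G.Adj (u i) (u (i + 1)))
    (t : ℝ≥0) : EdgePoint G :=
  onEdge (hu ⌊t⌋₊) (t - ⌊t⌋₊) (tsub_le_iff_left.2 (Nat.lt_floor_add_one t).le)

section Walk

variable {u : ℕ → V} (hu : ∀ i, u i = u (i + 1) ∨ G.Adj (u i) (u (i + 1)))

lemma edist_vertex_add_le {u : ℕ → V}
    (hu : ∀ i, u i = u (i + 1) ∨ G.Adj (u i) (u (i + 1))) (i j : ℕ) : edist (vertex G (u i)) (vertex G (u (i + j))) ≤ j := by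
  induction j with
  | zero => simp
  | succ j ih =>
    refine (edist_triangle _ (vertex G (u (i + j))) _).trans ?_
    push_cast
    exact add_le_add ih (edist_vertex_le_one (hu _))

/-- Times in the same unit interval lie on one edge. Otherwise the bound adds the rest of the first
edge, the full edges in between and the beginning of the last one. -/
lemma edist_walk_le_of_le {s t : ℝ≥0} (hst : s ≤ t) :
    edist (walk u hu s) (walk u hu t) ≤ edist s t := by
  have hs := Nat.floor_le (zero_le (a := s))
  have ht := Nat.floor_le (zero_le (a := t))
  have hs' := (Nat.lt_floor_add_one s).le
  rcases (Nat.floor_le_floor hst).eq_or_lt with h | h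
  · have key : ∀ (i j : ℕ) (hi : s - i ≤ 1) (hj : t - j ≤ 1), (i : ℝ≥0) ≤ s → (j : ℝ≥0) ≤ t → i = j →
        edist (onEdge (hu i) (s - i) hi) (onEdge (hu j) (t - j) hj) ≤ edist s t := by
      rintro i j hi hj his hjt rfl
      refine (edist_onEdge_le _ _ _).trans (le_of_eq ?_)
      rw [edist_dist, edist_dist, NNReal.dist_eq, NNReal.dist_eq, NNReal.coe_sub his,
        NNReal.coe_sub hjt, sub_sub_sub_cancel_right]
    exact key _ _ _ _ hs ht h
  · obtain ⟨j, hj⟩ := Nat.exists_eq_add_of_le (Nat.succ_le_of_lt h)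
    have h1 : edist (walk u hu s) (vertex G (u (⌊s⌋₊ + 1))) ≤ _ := edist_onEdge_vertex_le _ _
    have h2 : edist (vertex G (u (⌊s⌋₊ + 1))) (vertex G (u ⌊t⌋₊)) ≤ j := by
      rw [hj]
      exact edist_vertex_add_le hu _ _
    have h3 : edist (vertex G (u ⌊t⌋₊)) (walk u hu t) ≤ _ := edist_vertex_onEdge_le _ _
    refine ((edist_triangle4 _ _ _ _).trans (add_le_add (add_le_add h1 h2) h3)).trans (le_of_eq ?_)
    rw [NNReal.edist_eq_of_add (c := (1 - (s - ⌊s⌋₊)) + j + (t - ⌊t⌋₊))]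
    · push_cast
      rfl
    · have h4 : s - ⌊s⌋₊ ≤ 1 := tsub_le_iff_left.2 hs'
      have h5 : (⌊t⌋₊ : ℝ) = ⌊s⌋₊ + 1 + j := by exact_mod_cast hj
      rw [← NNReal.coe_inj]
      push_cast [NNReal.coe_sub h4, NNReal.coe_sub hs, NNReal.coe_sub ht]
      linarith

lemma edist_walk_le (s t : ℝ≥0) : edist (walk u hu s) (walk u hu t) ≤ edist s t := by
  rcases le_total s t with h | h
  · exact edist_walk_le_of_le hu h
  · rw [edist_comm, edist_comm s]
    exact edist_walk_le_of_le hu h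

lemma edist_vertex_walk (i : ℕ) : edist (vertex G (u i)) (walk u hu i) = 0 := by
  have h : edist (vertex G (u ⌊(i : ℝ≥0)⌋₊)) (walk u hu i) ≤ _ := edist_vertex_onEdge_le _ _
  simpa using h

lemma edist_onEdge_walk {i : ℕ} {s : ℝ≥0} (hs : s ≤ 1) :
    edist (onEdge (hu i) s hs) (walk u hu (i + s)) = 0 := by
  rcases hs.lt_or_eq with h | rfl
  · have hfl : ⌊(i : ℝ≥0) + s⌋₊ = i := by
      rw [Nat.floor_eq_iff (by positivity)]
      exact ⟨le_self_add, by gcongr⟩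
    have key : ∀ (j : ℕ) (hj : (i + s) - j ≤ 1), j = i →
        edist (onEdge (hu i) s hs) (onEdge (hu j) ((i + s) - j) hj) = 0 := by
      rintro j hj rfl
      refine le_antisymm ((edist_onEdge_le _ _ _).trans (le_of_eq ?_)) bot_le
      simp
    exact key _ _ hfl
  · have h1 := edist_onEdge_vertex_le (hu i) le_rfl
    have h2 := edist_vertex_walk hu (i + 1)
    push_cast at h2
    exact le_antisymm ((edist_triangle _ _ _).trans ((add_le_add h1 h2.le).trans (by simp))) bot_le

end Walk

end EdgePoint

/-! ### Combings given by sequences of vertices -/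

/-- For each vertex an edge path from `o` to it, which may pause. -/
structure VertexCombing {V : Type*} (G : SimpleGraph V) (o : V) where
  path : V → ℕ → V
  len : V → ℕ
  path_zero : ∀ v, path v 0 = o
  path_of_len_le : ∀ v i, len v ≤ i → path v i = v
  step : ∀ v i, path v i = path v (i + 1) ∨ G.Adj (path v i) (path v (i + 1))

namespace VertexCombing

open EdgePoint

variable {V : Type*} {G : SimpleGraph V} {o : V} (c : VertexCombing G o)

/-- The path of the first end of an edge, followed by the edge. -/
def extend (p : EdgePoint G) (i : ℕ) : V := if i ≤ c.len p.src then c.path p.src i else p.tgt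

lemma extend_of_le {p : EdgePoint G} {i : ℕ} (h : i ≤ c.len p.src) :
    c.extend p i = c.path p.src i := if_pos h

lemma extend_zero (p : EdgePoint G) : c.extend p 0 = o :=
  (c.extend_of_le (Nat.zero_le _)).trans (c.path_zero _)

lemma extend_len (p : EdgePoint G) : c.extend p (c.len p.src) = p.src :=
  (c.extend_of_le le_rfl).trans (c.path_of_len_le _ _ le_rfl)

lemma extend_len_succ (p : EdgePoint G) : c.extend p (c.len p.src + 1) = p.tgt :=
  if_neg (by omega)

lemma extend_step (p : EdgePoint G) (i : ℕ) :
    c.extend p i = c.extend p (i + 1) ∨ G.Adj (c.extend p i) (c.extend p (i + 1)) := by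
  rcases lt_trichotomy i (c.len p.src) with h | h | h
  · rw [c.extend_of_le h.le, c.extend_of_le h]
    exact c.step _ _
  · subst h
    rw [extend_len, extend_len_succ]
    rcases p.adj_or_eq with h | h
    · exact Or.inr h
    · exact Or.inl h.1
  · left
    rw [extend, extend, if_neg (by omega), if_neg (by omega)]

/-- The path to a point of an edge. -/
noncomputable def toPath (p : EdgePoint G) : BasedPath G.MetricGraph (G.vertexPoint o) where
  len := c.len p.src + p.pos
  toFun t := SeparationQuotient.mk (walk (c.extend p) (c.extend_step p) (min t (c.len p.src + p.pos)))
  continuous_toFun := by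
    have h : LipschitzWith 1 (walk (c.extend p) (c.extend_step p)) := fun s t => by
      rw [ENNReal.coe_one, one_mul]
      exact edist_walk_le _ s t
    exact SeparationQuotient.continuous_mk.comp
      (h.continuous.comp (continuous_id.min continuous_const))
  map_zero := by
    rw [zero_min, SimpleGraph.vertexPoint, SeparationQuotient.mk_eq_mk, EMetric.inseparable_iff,
      edist_comm]
    have := edist_vertex_walk (c.extend_step p) 0
    rw [c.extend_zero, Nat.cast_zero] at this
    exact this
  map_of_len_le t ht := by rw [min_eq_right ht, min_self]

lemma toPath_endpoint (p : EdgePoint G) : (c.toPath p).endpoint = SeparationQuotient.mk p := by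
  simp only [BasedPath.endpoint, toPath, min_self]
  rw [SeparationQuotient.mk_eq_mk, EMetric.inseparable_iff, edist_comm]
  refine le_antisymm ((edist_triangle _ (onEdge (c.extend_step p (c.len p.src)) p.pos
    p.pos_le_one) _).trans ?_) bot_le
  rw [edist_onEdge_walk, add_zero]
  have key : ∀ v w (h : v = w ∨ G.Adj v w), v = p.src → w = p.tgt →
      edist p (onEdge h p.pos p.pos_le_one) ≤ 0 := by
    rintro _ _ h rfl rfl
    unfold onEdge
    split_ifs with heq
    · rw [edist_comm]
      refine (edist_vertex_le p false).trans ?_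
      rcases p.adj_or_eq with h' | h'
      · exact absurd (heq ▸ h') (G.loopless.irrefl _)
      · simp [off, h'.2]
    · simp
  exact key _ _ _ (c.extend_len p) (c.extend_len_succ p)

lemma edist_toPath_le (p : EdgePoint G) (s t : ℝ≥0) :
    edist ((c.toPath p).toFun s) ((c.toPath p).toFun t) ≤ edist s t := by
  refine (SeparationQuotient.edist_mk _ _).le.trans ((edist_walk_le _ _ _).trans ?_)
  rw [edist_nndist, edist_nndist, ENNReal.coe_le_coe, ← NNReal.coe_le_coe, coe_nndist, coe_nndist,
    NNReal.dist_eq, NNReal.dist_eq]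
  push_cast
  exact abs_inf_sub_inf_le_abs _ _ _

/-- A path whose length is at most the distance of its ends is a geodesic. -/
lemma isGeodesic_toPath {p : EdgePoint G}
    (h : ((c.len p.src + p.pos : ℝ≥0) : ℝ≥0∞) ≤ edist (vertex G o) p) :
    (c.toPath p).IsGeodesic := by
  set γ := c.toPath p with hγ
  have hlen : γ.len = c.len p.src + p.pos := rfl
  have hend : edist (γ.toFun 0) (γ.toFun γ.len) = edist (vertex G o) p := by
    rw [γ.map_zero, show γ.toFun γ.len = SeparationQuotient.mk p from c.toPath_endpoint p]
    exact SeparationQuotient.edist_mk _ _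
  have key : ∀ s t : ℝ≥0, s ≤ t → t ≤ γ.len → edist (γ.toFun s) (γ.toFun t) = edist s t := by
    intro s t hst ht
    refine le_antisymm (c.edist_toPath_le p s t) ?_
    obtain ⟨a, rfl⟩ := exists_add_of_le hst
    obtain ⟨b, hb⟩ := exists_add_of_le ht
    have h1 := edist_triangle4 (γ.toFun 0) (γ.toFun s) (γ.toFun (s + a)) (γ.toFun γ.len)
    have h2 : edist (γ.toFun 0) (γ.toFun s) ≤ s :=
      (c.edist_toPath_le p 0 s).trans (NNReal.edist_eq_of_add (zero_add s).symm).le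
    have h3 : edist (γ.toFun (s + a)) (γ.toFun γ.len) ≤ b :=
      (c.edist_toPath_le p _ _).trans (NNReal.edist_eq_of_add hb).le
    rw [NNReal.edist_eq_of_add rfl]
    rw [← hlen, hb, ← hend] at h
    have h4 := h.trans (h1.trans (add_le_add (add_le_add h2 le_rfl) h3))
    push_cast at h4
    have h5 := (ENNReal.add_le_add_iff_right ENNReal.coe_ne_top).1 h4
    exact (ENNReal.add_le_add_iff_left ENNReal.coe_ne_top).1 h5
  intro s t hs ht
  rcases le_total s t with hst | hst
  · exact key s t hst ht
  · rw [edist_comm, edist_comm s]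
    exact key t s hst hs

/-- The paths to adjacent vertices stay at distance at most `C`, and so do their lengths. -/
def IsFellowTravelling (C : ℕ) : Prop :=
  ∀ v w, G.Adj v w → (∀ i, G.edist (c.path v i) (c.path w i) ≤ C) ∧ c.len v ≤ c.len w + C

variable {c}

/-- The bounds for adjacent vertices add up along a walk. -/
lemma IsFellowTravelling.of_walk {C : ℕ} (h : c.IsFellowTravelling C) {v w : V} (p : G.Walk v w) :
    (∀ i, G.edist (c.path v i) (c.path w i) ≤ (C * p.length : ℕ)) ∧
      c.len v ≤ c.len w + C * p.length := by
  induction p with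
  | nil => simp
  | cons hadj p ih =>
    obtain ⟨h1, h2⟩ := h _ _ hadj
    rw [SimpleGraph.Walk.length_cons, mul_add_one]
    refine ⟨fun i => SimpleGraph.edist_triangle.trans ((add_le_add (h1 i) (ih.1 i)).trans ?_), ?_⟩
    · norm_cast
      omega
    · omega

/-- Reduces the comparison of continuous paths to that of the vertex sequences at integer times. -/
lemma edist_toPath_vertex_le (p : EdgePoint G) (t : ℝ≥0) :
    edist ((c.toPath p).toFun t) (G.vertexPoint (c.path p.src ⌊t⌋₊)) ≤ 1 := by
  set L := c.len p.src
  have h1 : c.path p.src ⌊t⌋₊ = c.extend p (min ⌊t⌋₊ L) := by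
    rw [c.extend_of_le (min_le_right _ _)]
    rcases le_total ⌊t⌋₊ L with h | h
    · rw [min_eq_left h]
    · rw [min_eq_right h, c.path_of_len_le _ _ h, c.path_of_len_le _ _ le_rfl]
  refine (SeparationQuotient.edist_mk _ _).le.trans ?_
  refine (edist_triangle _ (walk (c.extend p) (c.extend_step p) (min ⌊t⌋₊ L : ℕ)) _).trans ?_
  have h2 := edist_vertex_walk (c.extend_step p) (min ⌊t⌋₊ L)
  rw [← h1, edist_comm] at h2
  refine (add_le_add (edist_walk_le _ _ _) h2.le).trans ?_
  rw [add_zero]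
  have ht := Nat.floor_le (zero_le (a := t))
  have ht' := (Nat.lt_floor_add_one t).le
  refine NNReal.edist_le_of_le_add (c := 1) ?_ ?_
  · push_cast
    rw [← min_add_add_right]
    exact min_le_min ht' (add_le_add le_rfl p.pos_le_one)
  · push_cast
    exact (min_le_min ht le_self_add).trans le_self_add

/-- Fellow travelling gives the upper bound of the quasi-isometric embedding; the lower bound holds
because the paths end at the given points. Any choice of names for the points works, since it
changes lengths and positions by a bounded amount. -/
theorem IsFellowTravelling.isCombing {C : ℕ} (h : c.IsFellowTravelling C)
    {rep : G.MetricGraph → EdgePoint G} (hrep : ∀ x, SeparationQuotient.mk (rep x) = x) :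
    IsCombing fun x => c.toPath (rep x) := by
  -- With `d = edist x y`, the first ends of the two edges have distance `D ≤ d + 2`. The lengths
  -- differ by at most `C * D + 1` and the paths by at most `C * D + 2`. The sum is at most `2 * C *
  -- d + (4 * C + 3)`.
  refine ⟨fun x => (c.toPath_endpoint _).trans (hrep x), 4 * C + 5, by positivity, fun x y => ?_⟩
  have hK : (1 : ℝ≥0∞) ≤ ((4 * C + 5 : ℝ≥0) : ℝ≥0∞) := by
    rw [ENNReal.one_le_coe_iff]
    exact le_add_of_nonneg_of_le (by positivity) (by norm_num)
  constructor
  · refine (ENNReal.div_le_of_le_mul ?_).trans le_self_add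
    refine le_trans ?_ (le_mul_of_one_le_right bot_le hK)
    -- At time `T` both paths have arrived, so `edist x y` is one of the terms of the supremum.
    set T := max (c.toPath (rep x)).len (c.toPath (rep y)).len
    have hx : (c.toPath (rep x)).toFun T = x := by
      rw [(c.toPath (rep x)).map_of_len_le T (le_max_left _ _)]
      exact (c.toPath_endpoint _).trans (hrep x)
    have hy : (c.toPath (rep y)).toFun T = y := by
      rw [(c.toPath (rep y)).map_of_len_le T (le_max_right _ _)]
      exact (c.toPath_endpoint _).trans (hrep y)
    have : edist x y ≤ ⨆ t, edist ((c.toPath (rep x)).toFun t) ((c.toPath (rep y)).toFun t) := by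
      refine le_trans ?_ (le_iSup _ T)
      rw [hx, hy]
    exact this.trans le_add_self
  · set p := rep x with hp
    set q := rep y with hq
    have hD : ((G.edist p.src q.src : ℕ∞) : ℝ≥0∞) ≤ edist x y + 2 := by
      rw [← edist_vertex_vertex]
      have h1 : edist (vertex G p.src) p ≤ 1 :=
        (edist_vertex_le p false).trans (by exact_mod_cast p.pos_le_one)
      have h2 : edist q (vertex G q.src) ≤ 1 := by
        rw [edist_comm]
        exact (edist_vertex_le q false).trans (by exact_mod_cast q.pos_le_one)
      have h3 : edist p q = edist x y := by
        rw [← hrep x, ← hrep y]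
        exact (SeparationQuotient.edist_mk _ _).symm
      refine (edist_triangle4 _ p q _).trans
        ((add_le_add (add_le_add h1 h3.le) h2).trans (le_of_eq ?_))
      ring
    by_cases htop : edist x y = ⊤
    · rw [htop, ENNReal.mul_top (by exact_mod_cast (by positivity : (4 * C + 5 : ℝ≥0) ≠ 0)), top_add]
      exact le_top
    have hfin : G.edist p.src q.src ≠ ⊤ := by
      intro h'
      rw [h', ENat.toENNReal_top, top_le_iff, ENNReal.add_eq_top] at hD
      exact hD.elim htop (by simp)
    obtain ⟨w, hw⟩ := (SimpleGraph.reachable_of_edist_ne_top hfin).exists_walk_length_eq_edist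
    obtain ⟨h1, h2⟩ := h.of_walk w
    obtain ⟨-, h3⟩ := h.of_walk w.reverse
    rw [SimpleGraph.Walk.length_reverse] at h3
    set D := w.length
    rw [← hw] at hD
    have hlen : edist (c.toPath p).len (c.toPath q).len ≤ ((C * D + 1 : ℝ≥0) : ℝ≥0∞) := by
      have hq1 := q.pos_le_one
      have hp1 := p.pos_le_one
      have h2' : (c.len p.src : ℝ≥0) ≤ c.len q.src + C * D := by exact_mod_cast h2
      have h3' : (c.len q.src : ℝ≥0) ≤ c.len p.src + C * D := by exact_mod_cast h3
      refine NNReal.edist_le_of_le_add ?_ ?_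
      · calc (c.len p.src + p.pos : ℝ≥0) ≤ c.len q.src + C * D + 1 := add_le_add h2' hp1
          _ ≤ c.len q.src + q.pos + (C * D + 1) := by
            rw [add_assoc]; gcongr; exact le_self_add
      · calc (c.len q.src + q.pos : ℝ≥0) ≤ c.len p.src + C * D + 1 := add_le_add h3' hq1
          _ ≤ c.len p.src + p.pos + (C * D + 1) := by
            rw [add_assoc]; gcongr; exact le_self_add
    have hsup : (⨆ t, edist ((c.toPath p).toFun t) ((c.toPath q).toFun t)) ≤
        ((C * D + 2 : ℝ≥0) : ℝ≥0∞) := by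
      refine iSup_le fun t => ?_
      have h4 := edist_toPath_vertex_le (c := c) p t
      have h5 := edist_toPath_vertex_le (c := c) q t
      rw [edist_comm] at h5
      have h6 : edist (G.vertexPoint (c.path p.src ⌊t⌋₊)) (G.vertexPoint (c.path q.src ⌊t⌋₊)) ≤
          (C * D : ℝ≥0) := by
        refine (SeparationQuotient.edist_mk _ _).le.trans ((edist_vertex_vertex _ _).le.trans ?_)
        refine (ENat.toENNReal_mono (h1 _)).trans (le_of_eq ?_)
        simp
      refine (edist_triangle4 _ _ _ _).trans
        ((add_le_add (add_le_add h4 h6) h5).trans (le_of_eq ?_))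
      push_cast
      ring
    refine (add_le_add hlen hsup).trans ?_
    have hD' : (D : ℝ≥0∞) ≤ edist x y + 2 := by simpa using hD
    calc ((C * D + 1 : ℝ≥0) : ℝ≥0∞) + ((C * D + 2 : ℝ≥0) : ℝ≥0∞) = 2 * C * D + 3 := by
          push_cast; ring
      _ ≤ 2 * C * (edist x y + 2) + 3 := by gcongr
      _ = 2 * C * edist x y + (4 * C + 3) := by ring
      _ ≤ (4 * C + 5) * edist x y + (4 * C + 5) := by
          gcongr
          · refine le_trans ?_ le_self_add
            gcongr
            norm_num
          · norm_num
      _ = _ := by push_cast; rfl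

end VertexCombing

namespace SubdivisionRule.Complex

open EdgePoint

variable {n : ℕ} {R : SubdivisionRule.{u} n} (X : SubdivisionRule.Complex.{u, v} R)

/-! ### The vertical combing of the history graph -/

/-- The distance of a vertex from the origin. -/
def height : X.HistoryVertex → ℕ
  | none => 0
  | some ⟨k, _⟩ => k + 1

/-- The lower end of the vertical edge below a vertex; the origin for the origin itself. -/
noncomputable def below : X.HistoryVertex → X.HistoryVertex
  | none => none
  | some ⟨0, _⟩ => none
  | some ⟨k + 1, e⟩ => some ⟨k, X.parent e⟩

lemma isBelow_below {v : X.HistoryVertex} (h : 0 < X.height v) : X.IsBelow (X.below v) v := by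
  rcases v with _ | ⟨_ | k, e⟩
  · simp [height] at h
  · simp [below, IsBelow]
  · exact ⟨rfl, X.subset_parent e⟩

lemma eq_below {v w : X.HistoryVertex} (h : X.IsBelow v w) : v = X.below w := by
  rcases v with _ | ⟨k, e⟩ <;> rcases w with _ | ⟨l, e'⟩
  · exact h.elim
  · obtain rfl : l = 0 := h
    rfl
  · exact h.elim
  · obtain ⟨rfl, h⟩ := h
    rw [below, X.eq_parent h]

lemma height_of_isBelow {v w : X.HistoryVertex} (h : X.IsBelow v w) :
    X.height w = X.height v + 1 := by
  rcases v with _ | ⟨k, e⟩ <;> rcases w with _ | ⟨l, e'⟩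
  · exact h.elim
  · obtain rfl : l = 0 := h
    rfl
  · exact h.elim
  · obtain ⟨rfl, h⟩ := h
    rfl

lemma height_of_isFace {v w : X.HistoryVertex} (h : X.IsFace v w) : X.height v = X.height w := by
  rcases v with _ | ⟨k, e⟩ <;> rcases w with _ | ⟨l, e'⟩
  · exact h.elim
  · exact h.elim
  · exact h.elim
  · obtain ⟨rfl, h⟩ := h
    rfl

/-- On level 0 both vertices lie over the origin; above it this is `parent_eq_or_face`. Iterated, it
keeps the vertical paths of a horizontal edge within one edge of each other. -/
lemma below_of_isFace {v w : X.HistoryVertex} (h : X.IsFace v w) :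
    X.below v = X.below w ∨ X.IsFace (X.below v) (X.below w) := by
  rcases v with _ | ⟨k, e⟩ <;> rcases w with _ | ⟨l, e'⟩
  · exact h.elim
  · exact h.elim
  · exact h.elim
  · obtain ⟨rfl, h⟩ := h
    rcases k with _ | k
    · exact Or.inl rfl
    · rcases X.parent_eq_or_face h with h' | h'
      · left
        rw [below, below, h']
      · exact Or.inr ⟨rfl, h'⟩

lemma height_below (v : X.HistoryVertex) : X.height (X.below v) = X.height v - 1 := by
  rcases v with _ | ⟨_ | k, e⟩ <;> rfl

lemma height_iterate_below (v : X.HistoryVertex) (j : ℕ) :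
    X.height (X.below^[j] v) = X.height v - j := by
  induction j with
  | zero => rfl
  | succ j ih => rw [Function.iterate_succ_apply', height_below, ih, Nat.sub_sub]

lemma eq_none_of_height {v : X.HistoryVertex} (h : X.height v = 0) : v = none := by
  rcases v with _ | ⟨k, e⟩
  · rfl
  · simp [height] at h

lemma iterate_below_of_isFace {v w : X.HistoryVertex} (h : X.IsFace v w) (j : ℕ) :
    X.below^[j] v = X.below^[j] w ∨ X.IsFace (X.below^[j] v) (X.below^[j] w) := by
  induction j with
  | zero => exact Or.inr h
  | succ j ih =>
    simp only [Function.iterate_succ_apply']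
    rcases ih with ih | ih
    · exact Or.inl (by rw [ih])
    · exact X.below_of_isFace ih

/-- The vertex of height `i` below `v`. -/
noncomputable def ancestor (v : X.HistoryVertex) (i : ℕ) : X.HistoryVertex :=
  X.below^[X.height v - i] v

lemma ancestor_of_le {v : X.HistoryVertex} {i : ℕ} (h : X.height v ≤ i) : X.ancestor v i = v := by
  rw [ancestor, Nat.sub_eq_zero_of_le h]
  rfl

lemma isBelow_ancestor {v : X.HistoryVertex} {i : ℕ} (h : i < X.height v) :
    X.IsBelow (X.ancestor v i) (X.ancestor v (i + 1)) := by
  rw [ancestor, ancestor, show X.height v - i = (X.height v - (i + 1)) + 1 by omega,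
    Function.iterate_succ_apply']
  refine X.isBelow_below ?_
  rw [height_iterate_below]
  omega

/-- The combing of the vertices by vertical paths. -/
noncomputable def verticalCombing : VertexCombing X.historyGraph none where
  path := X.ancestor
  len := X.height
  path_zero v := X.eq_none_of_height (by rw [ancestor, height_iterate_below]; omega)
  path_of_len_le v i h := X.ancestor_of_le h
  step v i := by
    rcases lt_or_ge i (X.height v) with h | h
    · exact Or.inr (Or.inl (X.isBelow_ancestor h))
    · rw [X.ancestor_of_le h, X.ancestor_of_le (h.trans (Nat.le_succ i))]
      exact Or.inl rfl

/-- Along a vertical edge the shorter path is an initial piece of the longer one. Along a horizontal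
edge both paths have the same length and descend through equal or adjacent vertices. -/
lemma isFellowTravelling_verticalCombing : X.verticalCombing.IsFellowTravelling 1 := by
  have hbelow : ∀ v w, X.IsBelow v w → ∀ i,
      X.historyGraph.edist (X.ancestor v i) (X.ancestor w i) ≤ 1 := by
    intro v w h i
    rw [SimpleGraph.edist_le_one_iff_adj_or_eq]
    have hh := X.height_of_isBelow h
    rcases le_or_gt i (X.height v) with hi | hi
    · right
      rw [ancestor, ancestor, hh, Nat.sub_add_comm hi, Function.iterate_succ_apply, ← X.eq_below h]
    · left
      rw [X.ancestor_of_le hi.le, X.ancestor_of_le (by omega)]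
      exact Or.inl h
  have hface : ∀ v w, X.IsFace v w → ∀ i,
      X.historyGraph.edist (X.ancestor v i) (X.ancestor w i) ≤ 1 := by
    intro v w h i
    rw [SimpleGraph.edist_le_one_iff_adj_or_eq, ancestor, ancestor, X.height_of_isFace h]
    rcases X.iterate_below_of_isFace h (X.height w - i) with h' | h'
    · exact Or.inr h'
    · exact Or.inl (Or.inr (Or.inr (Or.inl h')))
  intro v w h
  rw [Nat.cast_one]
  rcases h with h | h | h | h
  · exact ⟨hbelow v w h, by
      have : X.height v ≤ X.height w + 1 := by have := X.height_of_isBelow h; omega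
      exact this⟩
  · exact ⟨fun i => SimpleGraph.edist_comm.trans_le (hbelow w v h i),
      (X.height_of_isBelow h).le⟩
  · exact ⟨hface v w h, (X.height_of_isFace h).le.trans (Nat.le_succ _)⟩
  · exact ⟨fun i => SimpleGraph.edist_comm.trans_le (hface w v h i),
      (X.height_of_isFace h).ge.trans (Nat.le_succ _)⟩

lemma height_le_of_walk {v w : X.HistoryVertex} (p : X.historyGraph.Walk v w) :
    X.height w ≤ X.height v + p.length := by
  induction p with
  | nil => simp
  | cons h p ih =>
    rw [SimpleGraph.Walk.length_cons]
    refine ih.trans ?_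
    rcases h with h | h | h | h
    · have := X.height_of_isBelow h; omega
    · have := X.height_of_isBelow h; omega
    · have := X.height_of_isFace h; omega
    · have := X.height_of_isFace h; omega

/-- No edge raises the height by more than 1, and the origin has height 0. This is the lower bound
that makes vertical paths geodesic. -/
lemma height_le_edist (v : X.HistoryVertex) :
    (X.height v : ℝ≥0∞) ≤ ((X.historyGraph.edist none v : ℕ∞) : ℝ≥0∞) := by
  by_cases h : X.historyGraph.edist none v = ⊤
  · simp [h]
  · obtain ⟨p, hp⟩ := (SimpleGraph.reachable_of_edist_ne_top h).exists_walk_length_eq_edist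
    rw [← hp]
    have := X.height_le_of_walk p
    rw [show X.height none = 0 from rfl, zero_add] at this
    simpa using this

/-- The hypothesis says that reaching the point through `src` costs no more than reaching it through
`tgt`, namely `height src + pos ≤ height tgt + (1 - pos)`. -/
lemma height_add_pos_le_edist {p : EdgePoint X.historyGraph}
    (h : (X.height p.src : ℝ≥0) + 2 * p.pos ≤ X.height p.tgt + 1) :
    ((X.height p.src + p.pos : ℝ≥0) : ℝ≥0∞) ≤ edist (vertex X.historyGraph none) p := by
  refine le_edist_vertex fun a => ?_
  refine le_trans ?_ (add_le_add (X.height_le_edist _) le_rfl)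
  rw [← ENNReal.coe_natCast, ← ENNReal.coe_add, ENNReal.coe_le_coe]
  cases a
  · exact le_rfl
  · simp only [vert, off, if_true]
    rw [← NNReal.coe_le_coe] at h ⊢
    push_cast [NNReal.coe_sub p.pos_le_one] at h ⊢
    linarith

/-- Selects for each point the end of its edge through which the path from the origin is shortest.
Vertices receive their degenerate name, so that their paths do not finish along a horizontal edge.
-/
lemma exists_rep (x : X.HistorySpace) : ∃ p : EdgePoint X.historyGraph,
    SeparationQuotient.mk p = x ∧ (X.height p.src : ℝ≥0) + 2 * p.pos ≤ X.height p.tgt + 1 ∧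
      ((∃ v, x = X.historyGraph.vertexPoint v) → p.src = p.tgt) := by
  by_cases hx : ∃ v, x = X.historyGraph.vertexPoint v
  · obtain ⟨v, rfl⟩ := hx
    exact ⟨vertex _ v, rfl, by simp [vertex], fun _ => rfl⟩
  obtain ⟨p, rfl⟩ := SeparationQuotient.surjective_mk x
  rcases le_total ((X.height p.src : ℝ≥0) + 2 * p.pos) (X.height p.tgt + 1) with h | h
  · exact ⟨p, rfl, h, fun h' => absurd h' hx⟩
  rcases p.adj_or_eq with hadj | ⟨h1, h2⟩
  · refine ⟨⟨p.tgt, p.src, 1 - p.pos, tsub_le_self, Or.inl hadj.symm⟩, ?_, ?_,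
      fun h' => absurd h' hx⟩
    · rw [SeparationQuotient.mk_eq_mk, EMetric.inseparable_iff]
      refine le_antisymm ((pathDist_le_along (a := false) (b := true) ⟨rfl, rfl⟩).trans ?_) bot_le
      simp only [off, if_true, Bool.false_eq_true, if_false]
      rw [edist_self]
    · rw [← NNReal.coe_le_coe] at h ⊢
      push_cast [NNReal.coe_sub p.pos_le_one] at h ⊢
      linarith
  · exact ⟨p, rfl, by simp [h1, h2], fun _ => h1⟩

lemma toPath_mem_verticalPart {p : EdgePoint X.historyGraph} (hp : p.src = p.tgt) (t : ℝ≥0) :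
    (X.verticalCombing.toPath p).toFun t ∈ X.verticalPart := by
  refine ⟨_, rfl, ?_⟩
  unfold walk onEdge
  split_ifs with h
  · exact Or.inl rfl
  · right
    left
    change X.IsBelow (X.verticalCombing.extend p _) (X.verticalCombing.extend p (_ + 1))
    generalize ⌊min t _⌋₊ = i at h ⊢
    rcases lt_or_ge i (X.height p.src) with hi | hi
    · rw [VertexCombing.extend_of_le _ hi.le, VertexCombing.extend_of_le _ hi]
      exact X.isBelow_ancestor hi
    · refine absurd ?_ h
      have key : ∀ j, X.height p.src ≤ j → X.verticalCombing.extend p j = p.src := by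
        intro j hj
        unfold VertexCombing.extend
        split_ifs
        · exact X.ancestor_of_le hj
        · exact hp.symm
      rw [key i hi, key (i + 1) (hi.trans (Nat.le_succ i))]

theorem exists_vertical_combing :
    ∃ σ : X.HistorySpace → BasedPath X.HistorySpace X.origin,
      IsCombing σ ∧
      (∀ x, (σ x).IsGeodesic) ∧
      ∀ (v : X.HistoryVertex) (t : ℝ≥0),
        (σ (X.historyGraph.vertexPoint v)).toFun t ∈ X.verticalPart := by
  choose rep hrep hheight hvertex using X.exists_rep
  exact ⟨fun x => X.verticalCombing.toPath (rep x),
    X.isFellowTravelling_verticalCombing.isCombing hrep,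
    fun x => X.verticalCombing.isGeodesic_toPath (X.height_add_pos_le_edist (hheight x)),
    fun v t => X.toPath_mem_verticalPart (hvertex _ ⟨v, rfl⟩) t⟩

end SubdivisionRule.Complex

/-! ### Groups with bounded combings -/

/-- A combing of a group by sequences: the quotients of consecutive terms range over a finite set,
and so do, for each `s`, the quotients of the terms of the sequences of `g` and `g * s`. -/
structure BoundedCombing (G : Type*) [Group G] where
  path : G → ℕ → G
  len : G → ℕ
  path_zero : ∀ g, path g 0 = 1
  path_of_len_le : ∀ g i, len g ≤ i → path g i = g
  finite_step : (range fun x : G × ℕ => (path x.1 x.2)⁻¹ * path x.1 (x.2 + 1)).Finite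
  finite_quotient : ∀ s, (range fun x : G × ℕ => (path x.1 x.2)⁻¹ * path (x.1 * s) x.2).Finite
  len_le : ∀ s, ∃ C, ∀ g, len (g * s) ≤ len g + C

/-- Properties that are monotone in a natural number hold uniformly on a finite set. -/
lemma Set.Finite.exists_uniform_nat {α : Type*} {F : Set α} (hF : F.Finite) {P : α → ℕ → Prop}
    (mono : ∀ a m n, m ≤ n → P a m → P a n) (h : ∀ a ∈ F, ∃ n, P a n) :
    ∃ n, ∀ a ∈ F, P a n := by
  induction F, hF using Set.Finite.induction_on with
  | empty => exact ⟨0, by simp⟩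
  | @insert a F _ _ ih =>
    obtain ⟨n, hn⟩ := ih fun b hb => h b (mem_insert_of_mem _ hb)
    obtain ⟨m, hm⟩ := h a (mem_insert _ _)
    refine ⟨max m n, ?_⟩
    rintro b (rfl | hb)
    · exact mono _ _ _ (le_max_left _ _) hm
    · exact mono _ _ _ (le_max_right _ _) (hn b hb)

/-- `w` is a product of at most `n` conjugates of relators and inverses of relators. -/
inductive HasArea {α : Type*} (rels : Set (FreeGroup α)) : FreeGroup α → ℕ → Prop
  | one (n : ℕ) : HasArea rels 1 n
  | cons {w r : FreeGroup α} {n : ℕ} (g : FreeGroup α) (hr : r ∈ rels ∨ r⁻¹ ∈ rels)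
      (h : HasArea rels w n) : HasArea rels (g⁻¹ * r * g * w) (n + 1)

/-! ### Calculus of areas of words -/

namespace HasArea

variable {α : Type*} {rels : Set (FreeGroup α)} {w w' r : FreeGroup α} {m n : ℕ}

lemma mono (h : HasArea rels w m) (hmn : m ≤ n) : HasArea rels w n := by
  induction h generalizing n with
  | one => exact .one n
  | cons g hr h ih =>
    obtain ⟨n, rfl⟩ : ∃ n', n = n' + 1 := ⟨n - 1, by omega⟩
    exact .cons g hr (ih (by omega))

lemma mul (h : HasArea rels w m) (h' : HasArea rels w' n) : HasArea rels (w * w') (m + n) := by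
  induction h with
  | one m => simpa using h'.mono (Nat.le_add_left n m)
  | cons g hr h ih =>
    rw [mul_assoc, Nat.add_right_comm]
    exact .cons g hr ih

lemma of_mem (h : r ∈ rels ∨ r⁻¹ ∈ rels) (g : FreeGroup α) : HasArea rels (g⁻¹ * r * g) 1 := by
  simpa using HasArea.cons g h (.one 0)

lemma conj (h : HasArea rels w n) (a : FreeGroup α) : HasArea rels (a * w * a⁻¹) n := by
  induction h with
  | one n => simpa using .one n
  | @cons w r n g hr h ih =>
    have := HasArea.cons (g * a⁻¹) hr ih
    convert this using 1
    group

lemma inv (h : HasArea rels w n) : HasArea rels w⁻¹ n := by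
  induction h with
  | one n => simpa using .one n
  | @cons w r n g hr h ih =>
    have h1 : r⁻¹ ∈ rels ∨ r⁻¹⁻¹ ∈ rels := by rwa [inv_inv, or_comm]
    convert ih.mul (of_mem h1 g) using 1
    group

lemma mem_normalClosure (h : HasArea rels w n) : w ∈ Subgroup.normalClosure rels := by
  induction h with
  | one => exact one_mem _
  | @cons w r n g hr h ih =>
    have h1 : r ∈ Subgroup.normalClosure rels := by
      rcases hr with hr | hr
      · exact Subgroup.subset_normalClosure hr
      · exact inv_mem_iff.1 (Subgroup.subset_normalClosure hr)
    refine mul_mem ?_ ih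
    simpa using Subgroup.normalClosure_normal.conj_mem r h1 g⁻¹

/-- The words of finite area form a normal subgroup that contains the relators. -/
lemma exists_of_mem_normalClosure (h : w ∈ Subgroup.normalClosure rels) :
    ∃ n, HasArea rels w n := by
  let N : Subgroup (FreeGroup α) :=
    { carrier := {w | ∃ n, HasArea rels w n}
      one_mem' := ⟨0, .one 0⟩
      mul_mem' := fun ⟨m, h⟩ ⟨n, h'⟩ => ⟨m + n, h.mul h'⟩
      inv_mem' := fun ⟨m, h⟩ => ⟨m, h.inv⟩ }
  have : N.Normal := ⟨fun _ ⟨m, h⟩ a => ⟨m, h.conj a⟩⟩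
  have hle : Subgroup.normalClosure rels ≤ N := Subgroup.normalClosure_le_normal fun r hr =>
    ⟨1, by simpa using of_mem (Or.inl hr) 1⟩
  exact hle h

lemma wordArea_le (h : HasArea rels w n) : wordArea rels w ≤ n := by
  obtain ⟨l, h1, h2, h3⟩ : ∃ l : List (FreeGroup α × FreeGroup α),
      (∀ p ∈ l, p.2 ∈ rels ∨ p.2⁻¹ ∈ rels) ∧ (l.map fun p => p.1⁻¹ * p.2 * p.1).prod = w ∧
        l.length ≤ n := by
    induction h with
    | one n => exact ⟨[], by simp⟩
    | @cons w r n g hr h ih =>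
      obtain ⟨l, h1, h2, h3⟩ := ih
      refine ⟨(g, r) :: l, ?_, ?_, ?_⟩
      · intro p hp
        rcases List.mem_cons.1 hp with rfl | hp
        · exact hr
        · exact h1 p hp
      · rw [List.map_cons, List.prod_cons, h2]
      · simpa using h3
  exact (iInf₂_le l ⟨h1, h2⟩).trans (by exact_mod_cast h3)

end HasArea

/-! ### Quadratic area from a bounded combing -/

namespace BoundedCombing

variable {G : Type*} [Group G] (c : BoundedCombing G)

section Lift

variable {F : Type*} [Group F] (β : G → F)

/-- The lift of the beginning of a path. -/
def lift (g : G) : ℕ → F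
  | 0 => 1
  | i + 1 => lift g i * β ((c.path g i)⁻¹ * c.path g (i + 1))

variable {β}

lemma lift_eq (hβ1 : β 1 = 1) {g : G} {i : ℕ} (h : c.len g ≤ i) : c.lift β g i = c.lift β g (c.len g) := by
  induction i, h using Nat.le_induction with
  | base => rfl
  | succ i h ih =>
    rw [lift, c.path_of_len_le g i h, c.path_of_len_le g (i + 1) (h.trans (Nat.le_succ i)),
      inv_mul_cancel, hβ1, mul_one, ih]

end Lift

variable {m : ℕ} (π : FreeGroup (Fin m) →* G)

/-- The squares between the paths of two elements that differ by a generator. -/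
def squares (β : G → FreeGroup (Fin m)) : Set (FreeGroup (Fin m)) :=
  let B := range fun x : G × ℕ => (c.path x.1 x.2)⁻¹ * c.path x.1 (x.2 + 1)
  let D := ⋃ a : Fin m × Bool, range fun x : G × ℕ =>
    (c.path x.1 x.2)⁻¹ * c.path (x.1 * π (FreeGroup.mk [a])) x.2
  image2 (fun x y => β x.1 * β x.2 * (β y.1)⁻¹ * (β y.2)⁻¹) (B ×ˢ D) (B ×ˢ D) ∪
    range fun a : Fin m × Bool => FreeGroup.mk [a] * (β (π (FreeGroup.mk [a])))⁻¹

lemma finite_squares (β : G → FreeGroup (Fin m)) : (c.squares π β).Finite := by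
  have h : (⋃ a : Fin m × Bool, range fun x : G × ℕ =>
    (c.path x.1 x.2)⁻¹ * c.path (x.1 * π (FreeGroup.mk [a])) x.2).Finite :=
    finite_iUnion fun a => c.finite_quotient _
  exact ((c.finite_step.prod h).image2 _ (c.finite_step.prod h)).union (finite_range _)

variable {π} {β : G → FreeGroup (Fin m)} {rels : Set (FreeGroup (Fin m))} {A : ℕ}

/-- The strip between the lifted paths of `g` and `g * s`, cut off at time `i`. It is empty at time
0, and each time step adds one square, conjugated by the part of the lift already traversed. -/
lemma hasArea_strip (hβ : ∀ g, π (β g) = g) (hβ1 : β 1 = 1)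
    (hA : ∀ r ∈ c.squares π β ∩ (π.ker : Set (FreeGroup (Fin m))), HasArea rels r A)
    (g : G) (a : Fin m × Bool) (i : ℕ) :
    HasArea rels (c.lift β g i * β ((c.path g i)⁻¹ * c.path (g * π (FreeGroup.mk [a])) i) *
      (c.lift β (g * π (FreeGroup.mk [a])) i)⁻¹) (A * i) := by
  set s := π (FreeGroup.mk [a]) with hs
  induction i with
  | zero => simpa [c.path_zero, lift, hβ1] using .one 0
  | succ i ih =>
    set b := (c.path g i)⁻¹ * c.path g (i + 1) with hb
    set b' := (c.path (g * s) i)⁻¹ * c.path (g * s) (i + 1) with hb'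
    set d := (c.path g i)⁻¹ * c.path (g * s) i with hd
    set d' := (c.path g (i + 1))⁻¹ * c.path (g * s) (i + 1) with hd'
    have hsq : HasArea rels (β b * β d' * (β b')⁻¹ * (β d)⁻¹) A := by
      refine hA _ ⟨Or.inl ⟨(b, d'), ⟨⟨(g, i), rfl⟩, mem_iUnion.2 ⟨a, (g, i + 1), rfl⟩⟩, (b', d),
        ⟨⟨(g * s, i), rfl⟩, mem_iUnion.2 ⟨a, (g, i), rfl⟩⟩, rfl⟩, ?_⟩
      simp only [SetLike.mem_coe, MonoidHom.mem_ker, map_mul, map_inv, hβ]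
      rw [hb, hb', hd, hd']
      group
    have := (hsq.conj (c.lift β g i)).mul ih
    convert this using 1
    · rw [lift, lift, ← hb, ← hb']
      group
    · ring

/-- At a time when both paths have arrived, the difference closing the strip is the generator
itself, in the form of its chosen word `β s`. One more relator exchanges this word for the letter.
-/
lemma hasArea_lift_letter (hβ : ∀ g, π (β g) = g) (hβ1 : β 1 = 1)
    (hA : ∀ r ∈ c.squares π β ∩ (π.ker : Set (FreeGroup (Fin m))), HasArea rels r A)
    (g : G) (a : Fin m × Bool) :
    HasArea rels (c.lift β g (c.len g) * FreeGroup.mk [a] *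
      (c.lift β (g * π (FreeGroup.mk [a])) (c.len (g * π (FreeGroup.mk [a]))))⁻¹)
      (A * (c.len g + c.len (g * π (FreeGroup.mk [a])) + 1)) := by
  set s := π (FreeGroup.mk [a]) with hs
  have h1 := c.hasArea_strip hβ hβ1 hA g a (c.len g + c.len (g * s))
  rw [← hs, c.lift_eq hβ1 (Nat.le_add_right _ _), c.lift_eq hβ1 (Nat.le_add_left _ _),
    c.path_of_len_le _ _ (Nat.le_add_right _ _), c.path_of_len_le _ _ (Nat.le_add_left _ _),
    inv_mul_cancel_left] at h1
  have h2 : HasArea rels (FreeGroup.mk [a] * (β s)⁻¹) A := by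
    refine hA _ ⟨Or.inr ⟨a, rfl⟩, ?_⟩
    simp only [SetLike.mem_coe, MonoidHom.mem_ker, map_mul, map_inv, hβ]
    rw [← hs, mul_inv_cancel]
  convert (h2.conj (c.lift β g (c.len g))).mul h1 using 1
  · group
  · ring

/-- Stacks one strip per letter. The length of the paths grows by at most `C` per letter, so every
strip has at most `2 * (c.len g + C * l.length) + 1` relators. -/
lemma hasArea_lift_word (hβ : ∀ g, π (β g) = g) (hβ1 : β 1 = 1)
    (hA : ∀ r ∈ c.squares π β ∩ (π.ker : Set (FreeGroup (Fin m))), HasArea rels r A)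
    {C : ℕ}
    (hC : ∀ (a : Fin m × Bool) g, c.len (g * π (FreeGroup.mk [a])) ≤ c.len g + C)
    (l : List (Fin m × Bool)) (g : G) :
    HasArea rels (c.lift β g (c.len g) * FreeGroup.mk l *
      (c.lift β (g * π (FreeGroup.mk l)) (c.len (g * π (FreeGroup.mk l))))⁻¹)
      (A * (l.length * (2 * (c.len g + C * l.length) + 1))) := by
  induction l generalizing g with
  | nil =>
    have h : (FreeGroup.mk [] : FreeGroup (Fin m)) = 1 := rfl
    simpa [h] using .one 0
  | cons a l ih =>
    have h1 := c.hasArea_lift_letter hβ hβ1 hA g a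
    have h2 := ih (g * π (FreeGroup.mk [a]))
    have hmk : (FreeGroup.mk (a :: l) : FreeGroup (Fin m)) = FreeGroup.mk [a] * FreeGroup.mk l := by
      rw [FreeGroup.mul_mk, List.singleton_append]
    have h3 := h1.mul h2
    rw [mul_assoc g, ← map_mul, ← hmk] at h3
    have h8 : HasArea rels _ _ := HasArea.mono h3 (n := A * ((a :: l).length *
      (2 * (c.len g + C * (a :: l).length) + 1))) ?_
    · convert h8 using 1
      rw [hmk]
      group
    · have h4 := hC a g
      rw [← mul_add, List.length_cons]
      refine Nat.mul_le_mul le_rfl ?_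
      have h5 : 2 * (c.len (g * π (FreeGroup.mk [a])) + C * l.length) + 1 ≤
          2 * (c.len g + C * (l.length + 1)) + 1 := by rw [mul_add_one]; omega
      have h6 := Nat.mul_le_mul (le_refl l.length) h5
      have h7 : c.len g + c.len (g * π (FreeGroup.mk [a])) + 1 ≤
          2 * (c.len g + C * (l.length + 1)) + 1 := by rw [mul_add_one]; omega
      rw [add_one_mul]
      omega

/-- All relations of a group with a bounded combing follow from finitely many of them, the number of
these relations that is needed being quadratic. -/
theorem exists_finite_quadratic (c : BoundedCombing G) (hπ : Function.Surjective π) :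
    ∃ S : Set (FreeGroup (Fin m)), S.Finite ∧ S ⊆ π.ker ∧ ∃ a b : ℕ,
      ∀ (rels : Set (FreeGroup (Fin m))) (A : ℕ), (∀ r ∈ S, HasArea rels r A) →
        ∀ w ∈ π.ker, HasArea rels w (A * (a * w.norm ^ 2 + b * w.norm)) := by
  classical
  choose β₀ hβ₀ using hπ
  -- The trivial element must be lifted trivially: then the lifted path becomes constant after
  -- `len`, and the strips start as the empty word.
  let β : G → FreeGroup (Fin m) := fun g => if g = 1 then 1 else β₀ g
  have hβ : ∀ g, π (β g) = g := by
    intro g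
    by_cases h : g = 1
    · simp [β, h]
    · simp [β, h, hβ₀]
  have hβ1 : β 1 = 1 := if_pos rfl
  obtain ⟨C, hC⟩ := (finite_univ (α := Fin m × Bool)).exists_uniform_nat
    (P := fun a C => ∀ g, c.len (g * π (FreeGroup.mk [a])) ≤ c.len g + C)
    (fun a m n hmn h g => (h g).trans (by omega)) (fun a _ => c.len_le _)
  -- The set of squares also contains quadruples that do not close up; the kernel removes them. The
  -- coefficients are those of `hasArea_lift_word` at `g = 1`, where the same lift stands on both
  -- sides of `w` and is conjugated away.
  refine ⟨c.squares π β ∩ π.ker, (c.finite_squares π β).inter_of_left _, inter_subset_right,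
    2 * C, 2 * c.len 1 + 1, fun rels A hA w hw => ?_⟩
  have h := c.hasArea_lift_word hβ hβ1 hA (fun a => hC a (mem_univ a)) w.toWord 1
  rw [FreeGroup.mk_toWord, MonoidHom.mem_ker.1 hw, mul_one] at h
  convert h.conj (c.lift β 1 (c.len 1))⁻¹ using 1
  · group
  · rw [FreeGroup.norm]
    ring

theorem isFinitelyPresented (c : BoundedCombing G) (hπ : Function.Surjective π) :
    Group.IsFinitelyPresented G := by
  obtain ⟨S, hS, hSker, a, b, h⟩ := c.exists_finite_quadratic hπ
  refine ⟨m, π, hπ, S, hS, le_antisymm (Subgroup.normalClosure_le_normal hSker) fun w hw => ?_⟩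
  exact (h S 1 (fun r hr => by simpa using HasArea.of_mem (Or.inl hr) 1) w hw).mem_normalClosure

/-- The finite set of squares does not depend on the relators. Each square has some area with
respect to the given relators, and the largest of these only scales the quadratic bound. -/
theorem hasQuadraticIsoperimetricInequality (c : BoundedCombing G)
    (hπ : Function.Surjective π) :
    HasQuadraticIsoperimetricInequality G := by
  refine ⟨c.isFinitelyPresented hπ, fun k τ rels hτ _ hker => ?_⟩
  obtain ⟨S, hS, hSker, a, b, h⟩ := c.exists_finite_quadratic hτ
  obtain ⟨A, hA⟩ := hS.exists_uniform_nat (P := fun r A => HasArea rels r A)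
    (fun r m n hmn h => h.mono hmn)
    (fun r hr => HasArea.exists_of_mem_normalClosure (hker ▸ hSker hr))
  refine ⟨A * a, A * b, 0, fun j => iSup₂_le fun w hw => ?_⟩
  refine (h rels A hA w hw.1).wordArea_le.trans (le_of_eq ?_)
  rw [hw.2]
  congr 1
  ring

end BoundedCombing

/-! ### Distances in Cayley graphs -/

section Cayley

variable {G : Type*} [Group G] {T : Set G}

/-- A word for `s` in the generators can be read from every starting point `g`, which makes the
bound uniform. -/
lemma exists_mulCayley_edist_le (hT : Subgroup.closure T = ⊤) (s : G) :
    ∃ N : ℕ, ∀ g, (SimpleGraph.mulCayley T).edist g (g * s) ≤ N := by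
  have hs : s ∈ Subgroup.closure T := hT ▸ Subgroup.mem_top s
  induction hs using Subgroup.closure_induction with
  | mem s hs =>
    refine ⟨1, fun g => ?_⟩
    rw [Nat.cast_one, SimpleGraph.edist_le_one_iff_adj_or_eq, SimpleGraph.mulCayley_adj]
    by_cases h : g = g * s
    · exact Or.inr h
    · exact Or.inl ⟨h, Or.inl (by simpa using hs)⟩
  | one => exact ⟨0, by simp⟩
  | mul s t _ _ hs ht =>
    obtain ⟨M, hM⟩ := hs
    obtain ⟨N, hN⟩ := ht
    refine ⟨M + N, fun g => ?_⟩
    have h := hN (g * s)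
    rw [mul_assoc] at h
    exact (SimpleGraph.edist_triangle.trans (add_le_add (hM g) h)).trans (by push_cast; rfl)
  | inv s _ hs =>
    obtain ⟨N, hN⟩ := hs
    refine ⟨N, fun g => ?_⟩
    have := hN (g * s⁻¹)
    rwa [inv_mul_cancel_right, SimpleGraph.edist_comm] at this

/-- Pairs of elements with quotient in a given finite set have bounded distance. -/
lemma Set.Finite.exists_mulCayley_edist_le (hT : Subgroup.closure T = ⊤) {F : Set G}
    (hF : F.Finite) :
    ∃ N : ℕ, ∀ x y, x⁻¹ * y ∈ F → (SimpleGraph.mulCayley T).edist x y ≤ N := by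
  obtain ⟨N, hN⟩ := hF.exists_uniform_nat
    (P := fun s N => ∀ g, (SimpleGraph.mulCayley T).edist g (g * s) ≤ N)
    (fun s m n hmn h g => (h g).trans (by exact_mod_cast hmn))
    (fun s _ => _root_.exists_mulCayley_edist_le hT s)
  exact ⟨N, fun x y h => by simpa using hN _ h x⟩

/-- The quotients of the pairs of elements of bounded distance form a finite set. -/
lemma exists_finite_quotient_mem (hT : T.Finite) (N : ℕ) :
    ∃ F : Set G, F.Finite ∧ ∀ x y, (SimpleGraph.mulCayley T).edist x y ≤ N → x⁻¹ * y ∈ F := by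
  have key : ∀ N : ℕ, ∃ F : Set G, F.Finite ∧
      ∀ x y, ∀ p : (SimpleGraph.mulCayley T).Walk x y, p.length = N → x⁻¹ * y ∈ F := by
    intro N
    induction N with
    | zero =>
      refine ⟨{1}, finite_singleton 1, fun x y p hp => ?_⟩
      simp [p.eq_of_length_eq_zero hp]
    | succ N ih =>
      obtain ⟨F, hF, h⟩ := ih
      refine ⟨image2 (· * ·) (T ∪ T⁻¹) F, (hT.union hT.inv).image2 _ hF, fun x y p hp => ?_⟩
      cases p with
      | nil => simp at hp
      | @cons _ z _ hadj p =>
        rw [SimpleGraph.mulCayley_adj] at hadj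
        refine ⟨x⁻¹ * z, ?_, z⁻¹ * y, h z y p (by simpa using hp), by group⟩
        refine hadj.2.imp id fun h => ?_
        simpa using h
  choose F hF h using key
  refine ⟨⋃ i ∈ Iic N, F i, (finite_Iic N).biUnion fun i _ => hF i, fun x y hxy => ?_⟩
  obtain ⟨p, hp⟩ := (SimpleGraph.reachable_of_edist_ne_top
    (hxy.trans_lt (ENat.natCast_lt_top N)).ne).exists_walk_length_eq_edist
  rw [← hp] at hxy
  exact mem_biUnion (show p.length ∈ Iic N by simpa using hxy) (h _ x y p rfl)

end Cayley

/-! ### From quasi-isometries to combings of groups -/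

lemma BasedPath.IsGeodesic.edist_le {Y : Type*} [PseudoEMetricSpace Y] {O : Y} {γ : BasedPath Y O}
    (h : γ.IsGeodesic) (s t : ℝ≥0) : edist (γ.toFun s) (γ.toFun t) ≤ edist s t := by
  have hmin : ∀ t, γ.toFun t = γ.toFun (min t γ.len) := by
    intro t
    rcases le_total t γ.len with ht | ht
    · rw [min_eq_left ht]
    · rw [min_eq_right ht, γ.map_of_len_le t ht]
  rw [hmin s, hmin t, h _ _ (min_le_right _ _) (min_le_right _ _), edist_nndist, edist_nndist,
    ENNReal.coe_le_coe, ← NNReal.coe_le_coe, coe_nndist, coe_nndist, NNReal.dist_eq, NNReal.dist_eq]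
  push_cast
  exact abs_inf_sub_inf_le_abs _ _ _

lemma BasedPath.edist_toFun_le {Y : Type*} [PseudoEMetricSpace Y] {O : Y} (γ γ' : BasedPath Y O)
    (t : ℝ≥0) : edist (γ.toFun t) (γ'.toFun t) ≤ edist γ γ' :=
  (le_iSup (fun t => edist (γ.toFun t) (γ'.toFun t)) t).trans le_add_self

lemma BasedPath.edist_len_le {Y : Type*} [PseudoEMetricSpace Y] {O : Y} (γ γ' : BasedPath Y O) :
    edist γ.len γ'.len ≤ edist γ γ' := le_self_add

section QuasiIsometry

variable {G : Type*} [Group G] {T : Set G} {Y : Type*} [PseudoEMetricSpace Y]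

lemma edist_vertexPoint {V : Type*} {Γ : SimpleGraph V} (v w : V) :
    edist (Γ.vertexPoint v) (Γ.vertexPoint w) = ((Γ.edist v w : ℕ∞) : ℝ≥0∞) :=
  (SeparationQuotient.edist_mk _ _).trans (EdgePoint.edist_vertex_vertex v w)

/-- The restriction of a quasi-isometry of a Cayley graph to the vertices. -/
lemma exists_coarse_inverse (hT : T.Finite) (hgen : Subgroup.closure T = ⊤)
    {f : CayleySpace G T → Y} (hf : IsQuasiIsometry f) :
    ∃ φ : G → Y,
      (∀ r : ℝ≥0, ∃ F : Set G, F.Finite ∧ ∀ x y, edist (φ x) (φ y) ≤ r → x⁻¹ * y ∈ F) ∧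
      (∀ s, ∃ r : ℝ≥0, ∀ g, edist (φ g) (φ (g * s)) ≤ r) ∧
      ∃ (q : Y → G) (M : ℝ≥0), ∀ y, edist (φ (q y)) y ≤ M := by
  obtain ⟨K, ⟨hK, hqi⟩, hdense⟩ := hf
  refine ⟨fun g => f ((SimpleGraph.mulCayley T).vertexPoint g), fun r => ?_, fun s => ?_, ?_⟩
  · obtain ⟨N, hN⟩ := exists_nat_ge (K * (r + K))
    obtain ⟨F, hF, h⟩ := exists_finite_quotient_mem hT N
    refine ⟨F, hF, fun x y hxy => h x y ?_⟩
    have h1 := (hqi _ _).1.trans (add_le_add_left hxy K)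
    rw [edist_vertexPoint, ENNReal.div_le_iff_le_mul (Or.inl (by exact_mod_cast hK.ne'))
      (Or.inl ENNReal.coe_ne_top)] at h1
    have h2 : (((SimpleGraph.mulCayley T).edist x y : ℕ∞) : ℝ≥0∞) ≤ ((N : ℕ∞) : ℝ≥0∞) := by
      refine h1.trans ?_
      rw [mul_comm]
      simpa using (by exact_mod_cast hN : ((K * (r + K) : ℝ≥0) : ℝ≥0∞) ≤ ((N : ℝ≥0) : ℝ≥0∞))
    exact ENat.toENNReal_le.1 h2
  · obtain ⟨N, hN⟩ := exists_mulCayley_edist_le hgen s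
    refine ⟨K * N + K, fun g => ?_⟩
    refine (hqi _ _).2.trans ?_
    rw [edist_vertexPoint]
    push_cast
    gcongr
    simpa using ENat.toENNReal_mono (hN g)
  · choose x hx using hdense
    choose p hp using fun y => SeparationQuotient.surjective_mk (x y)
    -- One `K` for the distance from `y` to the image of `f`, and `K * 1 + K` for moving the
    -- preimage along its edge to a vertex.
    refine ⟨fun y => (p y).src, K + (K + K), fun y => ?_⟩
    rw [edist_comm]
    refine (edist_triangle _ (f (x y)) _).trans ?_
    push_cast
    refine add_le_add (hx y).le ((hqi _ _).2.trans ?_)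
    gcongr
    refine mul_le_of_le_one_right bot_le ?_
    rw [← hp y, edist_comm]
    refine (SeparationQuotient.edist_mk _ _).le.trans
      ((EdgePoint.edist_vertex_le (p y) false).trans ?_)
    exact_mod_cast (p y).pos_le_one

/-- A group quasi-isometric to a space with a geodesic combing has a bounded combing. -/
theorem exists_boundedCombing {O : Y} {σ : Y → BasedPath Y O} (hσ : IsCombing σ)
    (hgeo : ∀ y, (σ y).IsGeodesic) (hT : T.Finite) (hgen : Subgroup.closure T = ⊤)
    {f : CayleySpace G T → Y} (hf : IsQuasiIsometry f) : Nonempty (BoundedCombing G) := by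
  classical
  obtain ⟨φ, hfin, hstep, q, M₀, hq⟩ := exists_coarse_inverse hT hgen hf
  obtain ⟨hend, K, -, hK⟩ := hσ
  have hO : edist (φ 1) O ≤ (σ (φ 1)).len := by
    have h := (hgeo (φ 1)).edist_le (σ (φ 1)).len 0
    rw [(σ (φ 1)).map_zero, show (σ (φ 1)).toFun (σ (φ 1)).len = φ 1 from hend _, edist_comm _ 0,
      NNReal.edist_eq_of_add (zero_add _).symm] at h
    exact h
  -- The sequences are made to start at 1 although the paths start at `O`; the length of the path to
  -- `φ 1` bounds this error.
  set M := max M₀ (σ (φ 1)).len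
  -- The added 1 keeps the final value `g` from being required at time 0, where the sequence is set
  -- to 1.
  let len : G → ℕ := fun g => ⌈(σ (φ g)).len⌉₊ + 1
  let path : G → ℕ → G := fun g i =>
    if i = 0 then 1 else if len g ≤ i then g else q ((σ (φ g)).toFun i)
  have hnear : ∀ g i, edist (φ (path g i)) ((σ (φ g)).toFun i) ≤ M := by
    intro g i
    simp only [path]
    split_ifs with h0 hi
    · subst h0
      rw [Nat.cast_zero, (σ (φ g)).map_zero]
      exact hO.trans (by exact_mod_cast le_max_right _ _)
    · have h1 : (σ (φ g)).len ≤ i :=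
        (Nat.le_ceil _).trans (by exact_mod_cast (Nat.le_succ _).trans hi)
      rw [(σ (φ g)).map_of_len_le _ h1, show (σ (φ g)).toFun (σ (φ g)).len = φ g from hend _,
        edist_self]
      exact bot_le
    · exact (hq _).trans (by exact_mod_cast le_max_left _ _)
  have hpaths : ∀ s, ∃ r : ℝ≥0, ∀ g, edist (σ (φ g)) (σ (φ (g * s))) ≤ r := by
    intro s
    obtain ⟨r, hr⟩ := hstep s
    refine ⟨K * r + K, fun g => (hK _ _).2.trans ?_⟩
    push_cast
    gcongr
    exact hr g
  refine ⟨⟨path, len, fun g => if_pos rfl, fun g i hi => ?_, ?_, fun s => ?_, fun s => ?_⟩⟩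
  · simp only [path]
    rw [if_neg (by simp only [len] at hi; omega), if_pos hi]
  · obtain ⟨F, hF, h⟩ := hfin (M + 1 + M)
    refine hF.subset ?_
    rintro _ ⟨⟨g, i⟩, rfl⟩
    refine h _ _ ((edist_triangle4 _ ((σ (φ g)).toFun i) ((σ (φ g)).toFun (i + 1 : ℕ)) _).trans ?_)
    push_cast
    refine add_le_add (add_le_add (hnear g i) ?_) ?_
    · refine ((hgeo _).edist_le _ _).trans (NNReal.edist_eq_of_add (c := 1) rfl).le
    · rw [edist_comm]
      exact_mod_cast hnear g (i + 1)
  · obtain ⟨r, hr⟩ := hpaths s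
    obtain ⟨F, hF, h⟩ := hfin (M + r + M)
    refine hF.subset ?_
    rintro _ ⟨⟨g, i⟩, rfl⟩
    refine h _ _ ((edist_triangle4 _ ((σ (φ g)).toFun i) ((σ (φ (g * s))).toFun i) _).trans ?_)
    push_cast
    refine add_le_add (add_le_add (hnear g i) ?_) ?_
    · exact (BasedPath.edist_toFun_le _ _ _).trans (hr g)
    · rw [edist_comm]
      exact hnear _ i
  · obtain ⟨r, hr⟩ := hpaths s
    refine ⟨⌈r⌉₊, fun g => ?_⟩
    have h1 := (BasedPath.edist_len_le _ _).trans (hr g)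
    rw [edist_nndist, ENNReal.coe_le_coe, ← NNReal.coe_le_coe, coe_nndist, NNReal.dist_eq,
      abs_sub_le_iff] at h1
    have h2 : (σ (φ (g * s))).len ≤ (⌈(σ (φ g)).len⌉₊ + ⌈r⌉₊ : ℕ) := by
      have h3 : ((σ (φ (g * s))).len : ℝ) ≤ (σ (φ g)).len + r := by linarith [h1.2]
      have h4 : (σ (φ (g * s))).len ≤ (σ (φ g)).len + r := by exact_mod_cast h3
      refine h4.trans ?_
      push_cast
      exact add_le_add (Nat.le_ceil _) (Nat.le_ceil _)
    have h5 := Nat.ceil_le.2 h2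
    simp only [len]
    omega

end QuasiIsometry

/-! ### From bounded combings to combings of Cayley graphs -/

section Refine

variable {G : Type*} [Group G] {T : Set G}

/-- Edge paths from 1 that wait at their ends. The one for the trivial element is constant, so that
a path which has stopped stays put when its steps are filled in. -/
lemma exists_sequences (hT : Subgroup.closure T = ⊤) :
    ∃ a : G → ℕ → G, (∀ i, a 1 i = 1) ∧ (∀ b, a b 0 = 1) ∧
      (∀ b, ∃ m, ∀ i, m ≤ i → a b i = b) ∧
      ∀ b i, a b i = a b (i + 1) ∨ (SimpleGraph.mulCayley T).Adj (a b i) (a b (i + 1)) := by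
  have hreach : ∀ b, ∃ p : (SimpleGraph.mulCayley T).Walk 1 b, b = 1 → p.length = 0 := by
    intro b
    obtain ⟨N, hN⟩ := exists_mulCayley_edist_le hT b
    have h := hN 1
    rw [one_mul] at h
    obtain ⟨p, hp⟩ := (SimpleGraph.reachable_of_edist_ne_top
      (h.trans_lt (ENat.natCast_lt_top N)).ne).exists_walk_length_eq_edist
    refine ⟨p, fun hb => ?_⟩
    subst hb
    simpa using hp
  choose p hp using hreach
  refine ⟨fun b i => (p b).getVert i, fun i => ?_, fun b => (p b).getVert_zero, fun b => ?_,
    fun b i => ?_⟩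
  · exact (p 1).getVert_of_length_le ((hp 1 rfl).trans_le (Nat.zero_le i))
  · exact ⟨(p b).length, fun i hi => (p b).getVert_of_length_le hi⟩
  · rcases lt_or_ge i (p b).length with h | h
    · exact Or.inr ((p b).adj_getVert_succ h)
    · left
      beta_reduce
      rw [(p b).getVert_of_length_le h, (p b).getVert_of_length_le (h.trans (Nat.le_succ i))]

/-- A bounded combing gives a combing of each Cayley graph by edge paths. -/
theorem BoundedCombing.exists_vertexCombing (c : BoundedCombing G) (hT : T.Finite)
    (hgen : Subgroup.closure T = ⊤) :
    ∃ (d : VertexCombing (SimpleGraph.mulCayley T) (1 : G)) (C : ℕ), d.IsFellowTravelling C := by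
  obtain ⟨a, ha1, ha0, halim, hastep⟩ := exists_sequences hgen
  obtain ⟨N, hN⟩ := c.finite_step.exists_uniform_nat (P := fun b m => ∀ i, m ≤ i → a b i = b)
    (fun b m n hmn h i hi => h i (hmn.trans hi)) (fun b _ => halim b)
  have hadjmul : ∀ x b i, x * a b i = x * a b (i + 1) ∨
      (SimpleGraph.mulCayley T).Adj (x * a b i) (x * a b (i + 1)) := by
    intro x b i
    rw [SimpleGraph.mulCayley_adj_mul_iff_right, mul_right_inj]
    exact hastep b i
  let step : G → ℕ → G := fun g i => (c.path g i)⁻¹ * c.path g (i + 1)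
  have hlast : ∀ g i, c.path g i * a (step g i) N = c.path g (i + 1) := by
    intro g i
    rw [hN _ ⟨(g, i), rfl⟩ N le_rfl, mul_inv_cancel_left]
  -- Each step of the bounded combing is given a block of `N + 1` times, and its edge path is
  -- complete at offset `N`.
  let d : VertexCombing (SimpleGraph.mulCayley T) (1 : G) :=
    { path := fun g k => c.path g (k / (N + 1)) * a (step g (k / (N + 1))) (k % (N + 1))
      len := fun g => (N + 1) * c.len g
      path_zero := fun g => by simp [c.path_zero, ha0]
      path_of_len_le := fun g k hk => by
        have h : c.len g ≤ k / (N + 1) :=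
          (Nat.le_div_iff_mul_le (Nat.succ_pos N)).2 (by rwa [mul_comm])
        simp only [step]
        rw [c.path_of_len_le _ _ h, c.path_of_len_le _ _ (h.trans (Nat.le_succ _)), inv_mul_cancel,
          ha1, mul_one]
      step := fun g k => by
        have hlt : k % (N + 1) < N + 1 := Nat.mod_lt k (Nat.succ_pos N)
        have hdm := Nat.div_add_mod k (N + 1)
        rcases (Nat.lt_succ_iff.1 hlt).lt_or_eq with h | h
        · have h1 : (k + 1) / (N + 1) = k / (N + 1) ∧ (k + 1) % (N + 1) = k % (N + 1) + 1 :=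
            (Nat.div_mod_unique (b := N + 1) (Nat.succ_pos N)).2 ⟨by omega, by omega⟩
          rw [h1.1, h1.2]
          exact hadjmul _ _ _
        · have h1 : (k + 1) / (N + 1) = k / (N + 1) + 1 ∧ (k + 1) % (N + 1) = 0 :=
            (Nat.div_mod_unique (b := N + 1) (Nat.succ_pos N)).2
              ⟨by rw [mul_add_one]; omega, Nat.succ_pos N⟩
          -- At the end of a block the edge path has already reached the start of the next block, so
          -- the combing pauses for one unit.
          left
          rw [h1.1, h1.2, h, hlast, ha0, mul_one] }
  have hnear : ∀ g k, (SimpleGraph.mulCayley T).edist (c.path g (k / (N + 1))) (d.path g k) ≤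
      (N : ℕ) := by
    intro g k
    have key : ∀ x b j, (SimpleGraph.mulCayley T).edist x (x * a b j) ≤ (j : ℕ) := by
      intro x b j
      induction j with
      | zero => simp [ha0]
      | succ j ih =>
        push_cast
        exact SimpleGraph.edist_triangle.trans (add_le_add ih
          (SimpleGraph.edist_le_one_iff_adj_or_eq.2 (hadjmul x b j).symm))
    refine (key _ _ _).trans ?_
    exact_mod_cast Nat.lt_succ_iff.1 (Nat.mod_lt k (Nat.succ_pos N))
  have hS : (T ∪ T⁻¹).Finite := hT.union hT.inv
  obtain ⟨D, hD⟩ := (hS.biUnion fun s _ => c.finite_quotient s).exists_mulCayley_edist_le hgen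
  obtain ⟨C, hC⟩ := hS.exists_uniform_nat (P := fun s C => ∀ g, c.len (g * s) ≤ c.len g + C)
    (fun s m n hmn h g => (h g).trans (by omega)) (fun s _ => c.len_le s)
  -- `N` is the deviation within a block, `D` the distance between the two sequences, and `(N + 1) *
  -- C` the difference of lengths in the new time scale.
  refine ⟨d, N + D + N + (N + 1) * C, fun v w hvw => ?_⟩
  rw [SimpleGraph.mulCayley_adj] at hvw
  have hs : v⁻¹ * w ∈ T ∪ T⁻¹ := hvw.2.imp id fun h => by simpa using h
  have hs' : w⁻¹ * v ∈ T ∪ T⁻¹ := hvw.2.symm.imp id fun h => by simpa using h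
  constructor
  · intro k
    have h1 := hnear v k
    rw [SimpleGraph.edist_comm] at h1
    have h2 : (SimpleGraph.mulCayley T).edist (c.path v (k / (N + 1))) (c.path w (k / (N + 1))) ≤
        (D : ℕ) := by
      refine hD _ _ (mem_biUnion hs ⟨(v, k / (N + 1)), ?_⟩)
      simp
    refine (SimpleGraph.edist_triangle.trans (add_le_add (SimpleGraph.edist_triangle.trans
      (add_le_add h1 h2)) (hnear w k))).trans ?_
    exact_mod_cast Nat.le_add_right _ _
  · have h1 := hC _ hs' w
    rw [mul_inv_cancel_left] at h1
    calc (N + 1) * c.len v ≤ (N + 1) * (c.len w + C) := Nat.mul_le_mul le_rfl h1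
      _ ≤ (N + 1) * c.len w + (N + D + N + (N + 1) * C) := by rw [mul_add]; omega

theorem BoundedCombing.isCombableGroup (c : BoundedCombing G) : IsCombableGroup G := by
  intro T hT hgen
  obtain ⟨d, C, hd⟩ := c.exists_vertexCombing hT hgen
  choose rep hrep using SeparationQuotient.surjective_mk (X := EdgePoint (SimpleGraph.mulCayley T))
  exact ⟨_, hd.isCombing hrep⟩

end Refine

/-! ### The main theorem -/

lemma exists_freeGroup_fin_surjective {G : Type*} [Group G] {T : Set G} (hT : T.Finite)
    (hgen : Subgroup.closure T = ⊤) :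
    ∃ (m : ℕ) (π : FreeGroup (Fin m) →* G), Function.Surjective π := by
  have := hT.to_subtype
  obtain ⟨m, ⟨e⟩⟩ := Finite.exists_equiv_fin T
  refine ⟨m, FreeGroup.lift fun i => (e.symm i : G), ?_⟩
  rw [← MonoidHom.range_eq_top, ← top_le_iff, ← hgen, Subgroup.closure_le]
  intro t ht
  exact ⟨FreeGroup.of (e ⟨t, ht⟩), by simp⟩

theorem mainTheorem3 {n : ℕ} (R : SubdivisionRule.{u} n) (X : SubdivisionRule.Complex.{u, v} R) :
    (∃ σ : X.HistorySpace → BasedPath X.HistorySpace X.origin,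
      IsCombing σ ∧
      (∀ x, (σ x).IsGeodesic) ∧
      ∀ (v : X.HistoryVertex) (t : ℝ≥0),
        (σ (X.historyGraph.vertexPoint v)).toFun t ∈ X.verticalPart) ∧
    ∀ (G : Type w) [Group G], IsGroupQuasiIsometricTo G X.HistorySpace →
      IsCombableGroup G ∧ HasQuadraticIsoperimetricInequality G := by
  refine ⟨X.exists_vertical_combing, fun G _ ⟨T, hT, hgen, f, hf⟩ => ?_⟩
  obtain ⟨σ, hσ, hgeo, -⟩ := X.exists_vertical_combing
  obtain ⟨c⟩ := exists_boundedCombing hσ hgeo hT hgen hf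
  obtain ⟨m, π, hπ⟩ := exists_freeGroup_fin_surjective hT hgen
  exact ⟨c.isCombableGroup, c.hasQuadraticIsoperimetricInequality hπ⟩
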